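/- Let $K$ be a field. An \emph{alternating box} $(m,n)^{\varepsilon}$ ($m,n\ge 0$, $m+n$ even, $\varepsilon\in\{+,-\}$) is a rectangle with $m$ pins on its lower and $n$ pins on its upper edge, the pins of each edge being oriented alternately, starting from the left with $\varepsilon$ ($+$ is upward, $-$ is downward); for $m=n=0$ the sign is part of the datum. An \emph{alternating pod} $X_1\times\dots\times X_k\to Y$ is a planar diagram, up to planar isotopy, of oriented non-crossing strings (loops are allowed) inside the outer box $Y$ with numbered inner boxes $X_1,\dots,X_k$, in which every pin is the end of exactly one string, such that orientations agree at the pins and the regions can be given signs, changing across every string, so that a string going upward has a region of sign $+$ on its left, and the region at the left side of each (inner or outer) box has the sign of that box. With plugging of diagrams into inner boxes as composition, alternating pods form a multicategory $\mathcal{AD}$; let $\mathcal{AD}_+$ be its full submulticategory on the boxes $(m,n)^+$. A \emph{representation} of one of these multicategories assigns to every object $X$ a $K$-vector space $P_X$ and to every morphism $T:X_1\times\dots\times X_k\to Y$ a multilinear map $\pi_T:P_{X_1}\times\dots\times P_{X_k}\to P_Y$, compatibly with identities and plugging. We write $P^{\pm}_{m,n}=P_{(m,n)^{\pm}}$. We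 say that \emph{anticlockwise loops have value $d\in K$} if $\pi_T=d\,\pi_{T_0}$ whenever the pod $T_0$ is obtained from the pod $T$ by removing one anticlockwise loop that bounds a disk containing no other part of $T$ (so $\pi_T=d^{\,l}\pi_{T_0}$ if $l$ such loops are removed). Let $d\neq 0$, and let $(\pi^+,P^+)$ be a representation of $\mathcal{AD}_+$ in which anticlockwise loops have value $d$. Then $(\pi^+,P^+)$ extends to a representation $(\pi,P)$ of $\mathcal{AD}$ in which anticlockwise loops have value $d$, that is, there is such a representation together with an isomorphism of its restriction to $\mathcal{AD}_+$ with $(\pi^+,P^+)$. The extension is unique: for any other such extension there is exactly one isomorphism of representations of $\mathcal{AD}$ from $(\pi,P)$ to it that is compatible with the identifications of the restrictions with $(\pi^+,P^+)$. Moreover, for all $m,n$ with $m+n$ even, the map $P^-_{m,n}\to P^+_{m+1,n+1}$, $a\mapsto 1\otimes a$ (put an upward vertical string on the left of $a$), is injective, and $d^{-1}\pi^+_{1\otimes C}$ is a projection of $P^+_{m+1,n+1}$ onto its image, where $1\otimes C:(m+1,n+1)^+\to(m+1,n+1)^+$ is the pod consisting of an upward vertical string and, on its right, the inner box with its leftmost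 lower and leftmost upper pins joined by an arc passing on the left of the box. -/

import Mathlib

/-!
# The multicategory of alternating planar oriented diagrams, and its representations

A planar diagram is recorded in general position: reading it from bottom to top it is a finite
list of layers, each of which is a local minimum of a string (`cup`), a local maximum of a
string (`cap`) or an (upright) inner box, placed to the right of `pos` vertical strands.
Planar isotopy is the equivalence relation generated by the usual planar moves.

Alternation: on every horizontal line the strings are oriented alternately.  Equivalently the
regions carry signs, the sign changes across every string, and a string is oriented upwards
exactly when the region on its left has sign `+`.  The sign of a box is the sign of the region at
its left side, that is the orientation of its leftmost strings on the lower and on the upper edge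
(for a box without pins it is the sign of the region around it).
-/

namespace AltPod

/-- The objects: boxes with `lower` pins on the lower edge and `upper` pins on the upper edge,
an even number in total, decorated alternately and circularly, the decoration of both edges
starting from the left with `sign` (`true` is `+`, i.e. upward, `false` is `-`, i.e. downward). -/
structure Box where
  sign : Bool
  lower : ℕ
  upper : ℕ
  even : Even (lower + upper)

/-- The `p`-th term (`p = 0, 1, …`) of the alternating sequence that starts with `ε`. It is the
sign of the region to the right of `p` strands, and the orientation of the strand that follows
them, if the leftmost region has sign `ε`. -/
def altSign (ε : Bool) (p : ℕ) : Bool := xor ε p.bodd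

/-- What a layer contains: an arc `∪`, an arc `∩`, or the inner box with number `j`. -/
inductive Gen (k : ℕ) : Type
  | cup : Gen k
  | cap : Gen k
  | box (j : Fin k) : Gen k
  deriving DecidableEq

/-- A layer: `gen`, with exactly `pos` vertical strands on its left. -/
structure Layer (k : ℕ) : Type where
  pos : ℕ
  gen : Gen k

/-- The number of strands entering from below; `X` lists the types of the inner boxes. -/
def Gen.src {k : ℕ} (X : Fin k → Box) : Gen k → ℕ
  | .cup => 0
  | .cap => 2
  | .box j => (X j).lower

/-- The number of strands leaving above. -/
def Gen.tgt {k : ℕ} (X : Fin k → Box) : Gen k → ℕ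
  | .cup => 2
  | .cap => 0
  | .box j => (X j).upper

/-- A generator may be put into a region of sign `ε` (for an inner box the signs have to agree). -/
def Gen.Fits {k : ℕ} (X : Fin k → Box) (ε : Bool) : Gen k → Prop
  | .cup => True
  | .cap => True
  | .box j => (X j).sign = ε

/-- `Runs X ε m w n`: the layers `w`, stacked from bottom to top on `m` strands with leftmost
region of sign `ε`, fit together and end with `n` strands. -/
def Runs {k : ℕ} (X : Fin k → Box) (ε : Bool) : ℕ → List (Layer k) → ℕ → Prop
  | m, [], n => m = n
  | m, L :: w, n =>
      L.pos + L.gen.src X ≤ m ∧ L.gen.Fits X (altSign ε L.pos) ∧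
        Runs X ε (m - L.gen.src X + L.gen.tgt X) w n

/-- How often the inner box `j` occurs. -/
def boxCount {k : ℕ} (w : List (Layer k)) (j : Fin k) : ℕ :=
  w.countP fun L => decide (L.gen = Gen.box j)

/-- Add `p` vertical strands on the left. -/
def shift {k : ℕ} (p : ℕ) (w : List (Layer k)) : List (Layer k) :=
  w.map fun L => ⟨p + L.pos, L.gen⟩

/-- `m` nested arcs `∪`, with `p` strands on their left. -/
def cups {k : ℕ} (p m : ℕ) : List (Layer k) :=
  (List.range m).map fun i => ⟨p + i, Gen.cup⟩

/-- `n` nested arcs `∩`, with `p` strands on their left. -/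
def caps {k : ℕ} (p n : ℕ) : List (Layer k) :=
  (List.range n).reverse.map fun i => ⟨p + i, Gen.cap⟩

/-- The elementary planar isotopies.
* `slide`: two subdiagrams side by side (with `r` strands in between) are moved vertically past
  each other;
* `snake_left`, `snake_right`: a string is pulled straight;
* `turn`: a subdiagram turned upside down by a rotation through `π` is the same for the
  two directions of the rotation. -/
inductive Move {k : ℕ} (X : Fin k → Box) : List (Layer k) → List (Layer k) → Prop
  | slide (ε : Bool) (A B : List (Layer k)) (p m n r : ℕ) (hA : Runs X ε m A n) :
      Move X (shift p A ++ shift (p + n + r) B) (shift (p + m + r) B ++ shift p A)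
  | snake_left (p : ℕ) : Move X [⟨p + 1, Gen.cup⟩, ⟨p, Gen.cap⟩] []
  | snake_right (p : ℕ) : Move X [⟨p, Gen.cup⟩, ⟨p + 1, Gen.cap⟩] []
  | turn (ε : Bool) (A : List (Layer k)) (p m n : ℕ) (hA : Runs X ε m A n) :
      Move X (cups (p + n) m ++ shift (p + n) A ++ caps p n)
        (cups p m ++ shift (p + m) A ++ caps (p + m) n)

/-- An alternating diagram in the outer box `Y` with inner boxes `X 0, …, X (k - 1)`, each
occurring exactly once. -/
structure Diagram {k : ℕ} (X : Fin k → Box) (Y : Box) : Type where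
  word : List (Layer k)
  runs : Runs X Y.sign Y.lower word Y.upper
  once : ∀ j, boxCount word j = 1

/-- One elementary isotopy inside a diagram. -/
def Step {k : ℕ} {X : Fin k → Box} {Y : Box} (D D' : Diagram X Y) : Prop :=
  ∃ a x y b, D.word = a ++ x ++ b ∧ D'.word = a ++ y ++ b ∧ Move X x y

/-- The morphisms `X 0 × ⋯ × X (k - 1) → Y`: alternating pods, i.e. alternating diagrams up to
planar isotopy. -/
def Pod {k : ℕ} (X : Fin k → Box) (Y : Box) : Type :=
  Quot (Step (X := X) (Y := Y))

def Diagram.pod {k : ℕ} {X : Fin k → Box} {Y : Box} (D : Diagram X Y) : Pod X Y :=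
  Quot.mk _ D

/-! ### Identities and plugging -/

/-- The identity diagram: the inner box and vertical strands. -/
def Diagram.id (Y : Box) : Diagram (fun _ : Fin 1 => Y) Y where
  word := [⟨0, Gen.box 0⟩]
  runs := by simp [Runs, Gen.src, Gen.tgt, Gen.Fits, altSign]
  once := by intro j; simp [boxCount, Subsingleton.elim j 0]

/-- The types of the inner boxes after plugging, in lexicographic order. -/
abbrev plugBoxes {O : Type*} {k : ℕ} {κ : Fin k → ℕ} (Z : ∀ j, Fin (κ j) → O) :
    Fin (∑ j, κ j) → O :=
  fun s => Z (finSigmaFinEquiv.symm s).1 (finSigmaFinEquiv.symm s).2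

def Gen.relabel {k l : ℕ} (f : Fin k → Fin l) : Gen k → Gen l
  | .cup => .cup
  | .cap => .cap
  | .box j => .box (f j)

def relabel {k l : ℕ} (f : Fin k → Fin l) (w : List (Layer k)) : List (Layer l) :=
  w.map fun L => ⟨L.pos, L.gen.relabel f⟩

/-- Replace a layer consisting of the inner box `j` by the diagram `W j`. -/
def plugLayer {k : ℕ} {κ : Fin k → ℕ} (W : ∀ j, List (Layer (κ j))) (L : Layer k) :
    List (Layer (∑ j, κ j)) :=
  match L.gen with
  | .cup => [⟨L.pos, Gen.cup⟩]
  | .cap => [⟨L.pos, Gen.cap⟩]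
  | .box j => shift L.pos (relabel (fun i => finSigmaFinEquiv ⟨j, i⟩) (W j))

def plugWord {k : ℕ} {κ : Fin k → ℕ} (W : ∀ j, List (Layer (κ j))) (w : List (Layer k)) :
    List (Layer (∑ j, κ j)) :=
  w.flatMap (plugLayer W)

section facts

theorem altSign_add (ε : Bool) (p q : ℕ) : altSign ε (p + q) = altSign (altSign ε p) q := by
  simp [altSign, Nat.bodd_add]

theorem runs_append {k : ℕ} {X : Fin k → Box} {ε : Bool} (v : List (Layer k)) :
    ∀ (u : List (Layer k)) (m n l : ℕ), Runs X ε m u n → Runs X ε n v l →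
      Runs X ε m (u ++ v) l
  | [], m, n, l, h, h' => by simp only [Runs] at h; subst h; simpa using h'
  | L :: u, m, n, l, h, h' => by
      simp only [Runs, List.cons_append] at h ⊢
      exact ⟨h.1, h.2.1, runs_append v u _ _ _ h.2.2 h'⟩

theorem runs_shift {k : ℕ} {X : Fin k → Box} {ε : Bool} (p q : ℕ) :
    ∀ (w : List (Layer k)) (m n : ℕ), Runs X (altSign ε p) m w n →
      Runs X ε (p + m + q) (shift p w) (p + n + q)
  | [], m, n, h => by simp only [Runs] at h; subst h; simp [shift, Runs]
  | L :: w, m, n, h => by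
      simp only [Runs] at h
      obtain ⟨h1, h2, h3⟩ := h
      have ih := runs_shift p q w _ _ h3
      simp only [shift, List.map_cons, Runs, altSign_add] at ih ⊢
      refine ⟨by omega, h2, ?_⟩
      have e : p + m + q - L.gen.src X + L.gen.tgt X
          = p + (m - L.gen.src X + L.gen.tgt X) + q := by omega
      rw [e]; exact ih

theorem runs_relabel {k l : ℕ} {X : Fin k → Box} {X' : Fin l → Box} (f : Fin k → Fin l)
    (hf : ∀ j, X' (f j) = X j) {ε : Bool} :
    ∀ (w : List (Layer k)) (m n : ℕ), Runs X ε m w n → Runs X' ε m (relabel f w) n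
  | [], m, n, h => h
  | ⟨p, g⟩ :: w, m, n, h => by
      simp only [relabel, List.map_cons, Runs] at h ⊢
      have ih := runs_relabel f hf w _ _ h.2.2
      refine ⟨?_, ?_, ?_⟩
      · cases g <;> simpa [Gen.relabel, Gen.src, hf] using h.1
      · cases g
        · trivial
        · trivial
        · simpa [Gen.relabel, Gen.Fits, hf] using h.2.1
      · cases g <;> simpa [Gen.relabel, Gen.src, Gen.tgt, hf, relabel] using ih

variable {k : ℕ} {κ : Fin k → ℕ}

theorem plugBoxes_apply {O : Type*} (Z : ∀ j, Fin (κ j) → O) (j : Fin k) (i : Fin (κ j)) :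
    plugBoxes Z (finSigmaFinEquiv ⟨j, i⟩) = Z j i := by
  have h : ∀ s : (Σ j, Fin (κ j)), s = ⟨j, i⟩ → Z s.1 s.2 = Z j i := by
    rintro _ rfl; rfl
  exact h _ (Equiv.symm_apply_apply _ _)

theorem runs_plugWord {X : Fin k → Box} {Z : ∀ j, Fin (κ j) → Box}
    {W : ∀ j, List (Layer (κ j))}
    (hW : ∀ j, Runs (Z j) (X j).sign (X j).lower (W j) (X j).upper) {ε : Bool} :
    ∀ (w : List (Layer k)) (m n : ℕ), Runs X ε m w n →
      Runs (plugBoxes Z) ε m (plugWord W w) n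
  | [], m, n, h => h
  | ⟨p, g⟩ :: w, m, n, h => by
      simp only [Runs] at h
      obtain ⟨h1, h2, h3⟩ := h
      have ih := runs_plugWord hW w _ _ h3
      rw [plugWord, List.flatMap_cons]
      refine runs_append _ _ _ _ _ ?_ ih
      cases g with
      | cup => simpa [plugLayer, Runs, Gen.src, Gen.tgt, Gen.Fits] using h1
      | cap => simpa [plugLayer, Runs, Gen.src, Gen.tgt, Gen.Fits] using h1
      | box j =>
        simp only [Gen.src, Gen.tgt, Gen.Fits] at h1 h2 ⊢
        have hj := runs_relabel (X' := plugBoxes Z) (fun i => finSigmaFinEquiv ⟨j, i⟩)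
          (fun i => plugBoxes_apply Z j i) _ _ _ (hW j)
        rw [h2] at hj
        have := runs_shift p (m - (p + (X j).lower)) _ _ _ hj
        have e1 : p + (X j).lower + (m - (p + (X j).lower)) = m := by omega
        have e2 : p + (X j).upper + (m - (p + (X j).lower))
            = m - (X j).lower + (X j).upper := by omega
        rw [e1, e2] at this
        exact this

theorem boxCount_append (u v : List (Layer k)) (j : Fin k) :
    boxCount (u ++ v) j = boxCount u j + boxCount v j := by
  simp [boxCount, List.countP_append]

theorem boxCount_plugLayer (W : ∀ j, List (Layer (κ j))) (L : Layer k) (j : Fin k)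
    (i : Fin (κ j)) :
    boxCount (plugLayer W L) (finSigmaFinEquiv ⟨j, i⟩) = boxCount [L] j * boxCount (W j) i := by
  obtain ⟨p, g⟩ := L
  cases g with
  | cup => simp [plugLayer, boxCount]
  | cap => simp [plugLayer, boxCount]
  | box j' =>
    simp only [plugLayer, boxCount, shift, relabel, List.map_map, List.countP_map]
    by_cases hj : j' = j
    · subst hj
      simp only [List.countP_singleton, decide_true, if_true, one_mul]
      refine List.countP_congr ?_
      rintro ⟨q, g⟩ -
      cases g <;> simp [Gen.relabel]
    · simp only [List.countP_singleton, Gen.box.injEq, hj, decide_false, Bool.false_eq_true,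
        if_false, zero_mul, List.countP_eq_zero]
      rintro ⟨q, g⟩ -
      cases g <;> simp [Gen.relabel, hj]

theorem boxCount_plugWord (W : ∀ j, List (Layer (κ j))) (j : Fin k) (i : Fin (κ j)) :
    ∀ w : List (Layer k),
      boxCount (plugWord W w) (finSigmaFinEquiv ⟨j, i⟩) = boxCount w j * boxCount (W j) i
  | [] => by simp [plugWord, boxCount]
  | L :: w => by
      have ih := boxCount_plugWord W j i w
      have hL := boxCount_plugLayer W L j i
      rw [plugWord, List.flatMap_cons, boxCount_append, hL]
      rw [plugWord] at ih
      rw [ih, ← add_mul, ← boxCount_append]; rfl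

end facts

/-- Plugging the diagrams `E j` into the inner boxes of `D`. -/
def Diagram.plug {k : ℕ} {κ : Fin k → ℕ} {X : Fin k → Box} {Y : Box}
    {Z : ∀ j, Fin (κ j) → Box} (D : Diagram X Y) (E : ∀ j, Diagram (Z j) (X j)) :
    Diagram (plugBoxes Z) Y where
  word := plugWord (fun j => (E j).word) D.word
  runs := runs_plugWord (fun j => (E j).runs) _ _ _ D.runs
  once := by
    intro s
    obtain ⟨⟨j, i⟩, rfl⟩ := finSigmaFinEquiv.surjective s
    rw [boxCount_plugWord, D.once, (E j).once]

def Pod.id (Y : Box) : Pod (fun _ : Fin 1 => Y) Y := (Diagram.id Y).pod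

/-- Plugging of pods, computed on representatives (see `Pod.plug_pod`). -/
noncomputable def Pod.plug {k : ℕ} {κ : Fin k → ℕ} {X : Fin k → Box} {Y : Box}
    {Z : ∀ j, Fin (κ j) → Box} (T : Pod X Y) (S : ∀ j, Pod (Z j) (X j)) : Pod (plugBoxes Z) Y :=
  ((Quot.out T).plug fun j => Quot.out (S j)).pod

section welldefined

variable {k : ℕ} {κ : Fin k → ℕ}

theorem shift_append (p : ℕ) (u v : List (Layer k)) : shift p (u ++ v) = shift p u ++ shift p v :=
  List.map_append

theorem shift_shift (p q : ℕ) (u : List (Layer k)) : shift p (shift q u) = shift (p + q) u := by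
  simp [shift, Function.comp_def, add_assoc]

theorem shift_cups (p q m : ℕ) : shift p (cups q m : List (Layer k)) = cups (p + q) m := by
  simp [shift, cups, Function.comp_def, add_assoc]

theorem shift_caps (p q m : ℕ) : shift p (caps q m : List (Layer k)) = caps (p + q) m := by
  simp [shift, caps, Function.comp_def, add_assoc]

theorem Move.shift {X : Fin k → Box} {x y : List (Layer k)} (h : Move X x y) (q : ℕ) :
    Move X (AltPod.shift q x) (AltPod.shift q y) := by
  cases h with
  | slide ε A B p m n r hA =>
    simp only [shift_append, shift_shift]
    have := Move.slide ε A B (q + p) m n r hA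
    simpa only [add_assoc] using this
  | snake_left p => exact Move.snake_left (q + p)
  | snake_right p => exact Move.snake_right (q + p)
  | turn ε A p m n hA =>
    simp only [shift_append, shift_shift, shift_cups, shift_caps]
    have := Move.turn ε A (q + p) m n hA
    simpa only [add_assoc] using this

theorem Move.relabel {l : ℕ} {X : Fin k → Box} {X' : Fin l → Box} (f : Fin k → Fin l)
    (hf : ∀ j, X' (f j) = X j) {x y : List (Layer k)} (h : Move X x y) :
    Move X' (AltPod.relabel f x) (AltPod.relabel f y) := by
  have hs : ∀ p (w : List (Layer k)),
      AltPod.relabel f (AltPod.shift p w) = AltPod.shift p (AltPod.relabel f w) := by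
    intro p w; simp [AltPod.relabel, AltPod.shift, Function.comp_def]
  have ha : ∀ u v : List (Layer k),
      AltPod.relabel f (u ++ v) = AltPod.relabel f u ++ AltPod.relabel f v :=
    fun u v => List.map_append
  have hu : ∀ p m, AltPod.relabel f (cups p m) = cups p m := by
    intro p m; simp [AltPod.relabel, cups, Function.comp_def, Gen.relabel]
  have hc : ∀ p m, AltPod.relabel f (caps p m) = caps p m := by
    intro p m; simp [AltPod.relabel, caps, Function.comp_def, Gen.relabel]
  cases h with
  | slide ε A B p m n r hA =>
    simp only [ha, hs]; exact Move.slide ε _ _ p m n r (runs_relabel f hf _ _ _ hA)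
  | snake_left p => exact Move.snake_left p
  | snake_right p => exact Move.snake_right p
  | turn ε A p m n hA =>
    simp only [ha, hs, hu, hc]; exact Move.turn ε _ p m n (runs_relabel f hf _ _ _ hA)

theorem plugWord_append (W : ∀ j, List (Layer (κ j))) (u v : List (Layer k)) :
    plugWord W (u ++ v) = plugWord W u ++ plugWord W v := List.flatMap_append

theorem plugWord_shift (W : ∀ j, List (Layer (κ j))) (p : ℕ) :
    ∀ u : List (Layer k), plugWord W (shift p u) = shift p (plugWord W u)
  | [] => rfl
  | ⟨q, g⟩ :: u => by
      have ih := plugWord_shift W p u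
      have h1 : shift p (⟨q, g⟩ :: u) = [⟨p + q, g⟩] ++ shift p u := rfl
      have h2 : (⟨q, g⟩ :: u : List (Layer k)) = [⟨q, g⟩] ++ u := rfl
      rw [h1, h2, plugWord_append, plugWord_append, shift_append, ih]
      congr 1
      cases g with
      | cup => rfl
      | cap => rfl
      | box j => simp [plugWord, plugLayer, shift_shift]

theorem plugWord_cups (W : ∀ j, List (Layer (κ j))) (p m : ℕ) :
    plugWord W (cups p m) = cups p m := by
  simp only [plugWord, cups, List.flatMap_map]
  induction List.range m with
  | nil => rfl
  | cons a l ih => simp only [List.flatMap_cons, ih]; rfl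

theorem plugWord_caps (W : ∀ j, List (Layer (κ j))) (p m : ℕ) :
    plugWord W (caps p m) = caps p m := by
  simp only [plugWord, caps, List.flatMap_map]
  induction (List.range m).reverse with
  | nil => rfl
  | cons a l ih => simp only [List.flatMap_cons, ih]; rfl

theorem Move.plugWord {X : Fin k → Box} {Z : ∀ j, Fin (κ j) → Box}
    {W : ∀ j, List (Layer (κ j))}
    (hW : ∀ j, Runs (Z j) (X j).sign (X j).lower (W j) (X j).upper)
    {x y : List (Layer k)} (h : Move X x y) :
    Move (plugBoxes Z) (AltPod.plugWord W x) (AltPod.plugWord W y) := by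
  cases h with
  | slide ε A B p m n r hA =>
    simp only [plugWord_append, plugWord_shift]
    exact Move.slide ε _ _ p m n r (runs_plugWord hW _ _ _ hA)
  | snake_left p => exact Move.snake_left p
  | snake_right p => exact Move.snake_right p
  | turn ε A p m n hA =>
    simp only [plugWord_append, plugWord_shift, plugWord_cups, plugWord_caps]
    exact Move.turn ε _ p m n (runs_plugWord hW _ _ _ hA)

variable {X : Fin k → Box} {Y : Box} {Z : ∀ j, Fin (κ j) → Box}

theorem Step.plug_left {D D' : Diagram X Y} (h : Step D D') (E : ∀ j, Diagram (Z j) (X j)) :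
    Step (D.plug E) (D'.plug E) := by
  obtain ⟨a, x, y, b, h1, h2, hm⟩ := h
  refine ⟨plugWord (fun j => (E j).word) a, _, _, plugWord (fun j => (E j).word) b, ?_, ?_,
    hm.plugWord fun j => (E j).runs⟩
  · simp only [Diagram.plug, h1, plugWord_append]
  · simp only [Diagram.plug, h2, plugWord_append]

theorem plugWord_congr (W W' : ∀ j, List (Layer (κ j))) :
    ∀ w : List (Layer k), (∀ j, boxCount w j ≠ 0 → W j = W' j) → plugWord W w = plugWord W' w
  | [], _ => rfl
  | ⟨p, g⟩ :: w, h => by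
      have ih := plugWord_congr W W' w fun j hj => h j (by
        rw [← List.singleton_append, boxCount_append]; omega)
      simp only [plugWord, List.flatMap_cons] at ih ⊢
      rw [ih]
      congr 1
      cases g with
      | cup => rfl
      | cap => rfl
      | box j => simp only [plugLayer]; rw [h j (by simp [boxCount])]

theorem Step.plug_right (D : Diagram X Y) (E E' : ∀ j, Diagram (Z j) (X j)) (j : Fin k)
    (hj : Step (E j) (E' j)) (hne : ∀ i, i ≠ j → E i = E' i) :
    Step (D.plug E) (D.plug E') := by
  have hD := D.once j
  have hmem : ∃ L ∈ D.word, L.gen = Gen.box j := by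
    have : 0 < boxCount D.word j := by omega
    simpa [boxCount, List.countP_pos_iff] using this
  obtain ⟨⟨p, g⟩, hL, hg⟩ := hmem
  obtain ⟨u, v, huv⟩ := List.append_of_mem hL
  simp only at hg
  subst hg
  have hc : boxCount u j = 0 ∧ boxCount v j = 0 := by
    rw [huv, ← List.singleton_append, boxCount_append, boxCount_append] at hD
    simp only [boxCount, List.countP_singleton, decide_true, if_true] at hD ⊢
    omega
  obtain ⟨a, x, y, b, h1, h2, hm⟩ := hj
  have key : ∀ w : List (Layer k), boxCount w j = 0 →
      plugWord (fun i => (E i).word) w = plugWord (fun i => (E' i).word) w := by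
    intro w hw
    refine plugWord_congr _ _ _ fun i hi => ?_
    have : i ≠ j := by rintro rfl; exact hi hw
    simp only [hne i this]
  have hr : ∀ u v : List (Layer (κ j)), relabel (fun i => finSigmaFinEquiv ⟨j, i⟩) (u ++ v)
      = relabel (fun i => finSigmaFinEquiv ⟨j, i⟩) u
        ++ relabel (fun i => finSigmaFinEquiv ⟨j, i⟩) v := fun u v => List.map_append
  refine ⟨plugWord (fun i => (E i).word) u
      ++ shift p (relabel (fun i => finSigmaFinEquiv ⟨j, i⟩) a), _, _,
    shift p (relabel (fun i => finSigmaFinEquiv ⟨j, i⟩) b) ++ plugWord (fun i => (E i).word) v, ?_, ?_,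
    (hm.relabel (X' := plugBoxes Z) (fun i => finSigmaFinEquiv ⟨j, i⟩)
      fun i => plugBoxes_apply Z j i).shift p⟩
  · simp only [Diagram.plug]
    rw [huv, plugWord_append]
    simp only [plugWord, List.flatMap_cons, plugLayer, h1, hr, shift_append, List.append_assoc]
  · simp only [Diagram.plug]
    rw [huv, plugWord_append, key u hc.1, key v hc.2]
    simp only [plugWord, List.flatMap_cons, plugLayer, h2, hr, shift_append, List.append_assoc]

theorem pod_plug_left {D D' : Diagram X Y} (h : D.pod = D'.pod)
    (E : ∀ j, Diagram (Z j) (X j)) : (D.plug E).pod = (D'.plug E).pod := by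
  have h' := Quot.eqvGen_exact h
  clear h
  induction h' with
  | rel _ _ h => exact Quot.sound (h.plug_left E)
  | refl _ => rfl
  | symm _ _ _ ih => exact ih.symm
  | trans _ _ _ _ _ ih1 ih2 => exact ih1.trans ih2

theorem pod_plug_update (D : Diagram X Y) (E : ∀ j, Diagram (Z j) (X j)) (j : Fin k)
    {F F' : Diagram (Z j) (X j)} (h : F.pod = F'.pod) :
    (D.plug (Function.update E j F)).pod = (D.plug (Function.update E j F')).pod := by
  have h' := Quot.eqvGen_exact h
  clear h
  induction h' with
  | rel F F' h =>
    refine Quot.sound (Step.plug_right D _ _ j (by simpa using h) ?_)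
    intro i hi; simp [hi]
  | refl _ => rfl
  | symm _ _ _ ih => exact ih.symm
  | trans _ _ _ _ _ ih1 ih2 => exact ih1.trans ih2

theorem pod_plug_right (D : Diagram X Y) (E E' : ∀ j, Diagram (Z j) (X j))
    (h : ∀ j, (E j).pod = (E' j).pod) : (D.plug E).pod = (D.plug E').pod := by
  classical
  have key : ∀ s : Finset (Fin k),
      (D.plug E).pod = (D.plug fun j => if j ∈ s then E' j else E j).pod := by
    intro s
    induction s using Finset.induction_on with
    | empty => simp
    | insert a s ha ih =>
      rw [ih]
      have e1 : (fun j => if j ∈ s then E' j else E j)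
          = Function.update (fun j => if j ∈ s then E' j else E j) a (E a) := by
        rw [eq_comm, Function.update_eq_self_iff]; simp [ha]
      have e2 : (fun j => if j ∈ insert a s then E' j else E j)
          = Function.update (fun j => if j ∈ s then E' j else E j) a (E' a) := by
        funext j
        by_cases hj : j = a
        · subst hj; simp
        · simp [hj]
      rw [e2, e1, Function.update_idem]
      exact pod_plug_update D _ a (h a)
  simpa using key Finset.univ

/-- Plugging does not depend on the representatives. -/
theorem Pod.plug_pod (D : Diagram X Y) (E : ∀ j, Diagram (Z j) (X j)) :
    Pod.plug D.pod (fun j => (E j).pod) = (D.plug E).pod := by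
  refine (pod_plug_left (Quot.out_eq _) _).trans (pod_plug_right _ _ _ fun j => ?_)
  exact Quot.out_eq _

end welldefined

/-! ### Representations -/

universe u v

/-- A linear representation (functor to vector spaces and multilinear maps) of the
multicategory with objects `O` and morphisms the alternating pods between the boxes `o X`,
`X : O`. -/
structure Rep (K : Type u) [Field K] {O : Type} (o : O → Box) where
  V : O → Type v
  [addCommGroup : ∀ X, AddCommGroup (V X)]
  [module : ∀ X, Module K (V X)]
  /-- The multilinear map `π_T`. -/
  act : ∀ {k : ℕ} {X : Fin k → O} {Y : O}, Pod (fun i => o (X i)) (o Y) →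
    MultilinearMap K (fun i => V (X i)) (V Y)
  act_id : ∀ (Y : O) (x : Fin 1 → V Y), act (X := fun _ => Y) (Pod.id (o Y)) x = x 0
  act_plug : ∀ {k : ℕ} {X : Fin k → O} {Y : O} {κ : Fin k → ℕ} {Z : ∀ j, Fin (κ j) → O}
    (T : Pod (fun i => o (X i)) (o Y)) (S : ∀ j, Pod (fun i => o (Z j i)) (o (X j)))
    (x : ∀ j i, V (Z j i)),
    act (X := plugBoxes Z) (T.plug S)
        (fun s => x (finSigmaFinEquiv.symm s).1 (finSigmaFinEquiv.symm s).2)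
      = act T fun j => act (S j) (x j)

attribute [instance] Rep.addCommGroup Rep.module

/-- The boxes whose decoration starts with `+`. -/
abbrev PosBox : Type := {X : Box // X.sign = true}

/-- Representations of the multicategory of all alternating pods. -/
abbrev RepAD (K : Type u) [Field K] := Rep.{u, v} K (id : Box → Box)

/-- Representations of the full submulticategory on the boxes whose decoration starts
with `+`. -/
abbrev RepADPos (K : Type u) [Field K] := Rep.{u, v} K (Subtype.val : PosBox → Box)

section

variable {K : Type u} [Field K] {O : Type} {o : O → Box}

/-- `D` consists of `D₀` and one additional anticlockwise loop, bounding a disk that contains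
no other part of the diagram.  The loop is anticlockwise if its left strand goes downwards,
i.e. has sign `-`. -/
def AddsLoop {k : ℕ} {X : Fin k → Box} {Y : Box} (D D₀ : Diagram X Y) : Prop :=
  ∃ a b p, D.word = a ++ [⟨p, Gen.cup⟩, ⟨p, Gen.cap⟩] ++ b ∧ D₀.word = a ++ b ∧
    altSign Y.sign p = false

/-- Anticlockwise loops can be removed at the cost of a factor `d` each. -/
def Rep.LoopsEq (R : Rep.{u, v} K o) (d : K) : Prop :=
  ∀ {k : ℕ} {X : Fin k → O} {Y : O} (D D₀ : Diagram (fun i => o (X i)) (o Y)),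
    AddsLoop D D₀ → R.act D.pod = d • R.act D₀.pod

/-- The linear map given by a pod with one inner box. -/
def Rep.op (R : Rep.{u, v} K o) {X Y : O} (T : Pod (fun _ : Fin 1 => o X) (o Y)) :
    R.V X →ₗ[K] R.V Y :=
  (MultilinearMap.ofSubsingleton K (R.V X) (R.V Y) (0 : Fin 1)).symm (R.act (X := fun _ => X) T)

/-- Isomorphisms of representations: invertible intertwiners. -/
structure Rep.Iso (R R' : Rep.{u, v} K o) where
  equiv : ∀ X, R.V X ≃ₗ[K] R'.V X
  equiv_act : ∀ {k : ℕ} {X : Fin k → O} {Y : O} (T : Pod (fun i => o (X i)) (o Y))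
    (x : ∀ i, R.V (X i)), equiv Y (R.act T x) = R'.act T fun i => equiv (X i) (x i)

/-- Restriction of a representation to the boxes whose decoration starts with `+`. -/
def Rep.restrict (R : RepAD.{u, v} K) : RepADPos.{u, v} K where
  V X := R.V X.1
  act T := R.act T
  act_id Y x := R.act_id Y.1 x
  act_plug T S x := R.act_plug (O := Box) (o := id) T S x

end

/-! ### The pods `1 ⊗ a` and `1 ⊗ C` -/

/-- The box of type `(m, n)` with decoration starting with `-`. -/
abbrev negBox (m n : ℕ) (h : Even (m + n)) : Box := ⟨false, m, n, h⟩

/-- The box of type `(m + 1, n + 1)` with decoration starting with `+`. -/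
abbrev posBox (m n : ℕ) (h : Even (m + n)) : PosBox :=
  ⟨⟨true, m + 1, n + 1, by rw [show m + 1 + (n + 1) = m + n + 2 by ring]; exact h.add even_two⟩,
    rfl⟩

/-- `a ↦ 1 ⊗ a`: an upward vertical string on the left of the inner box. -/
def oneTensor (m n : ℕ) (h : Even (m + n)) :
    Diagram (fun _ : Fin 1 => negBox m n h) (posBox m n h).1 where
  word := [⟨1, Gen.box 0⟩]
  runs := by
    refine ⟨?_, ?_, ?_⟩ <;> simp [Runs, Gen.src, Gen.tgt, Gen.Fits, altSign] <;> omega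
  once := by intro j; simp [boxCount, Subsingleton.elim j 0]

/-- `1 ⊗ C`: an upward vertical string, and on its right the inner box with its leftmost lower
and upper pins connected by an arc that passes on the left of the box. -/
def oneTensorC (m n : ℕ) (h : Even (m + n)) :
    Diagram (fun _ : Fin 1 => (posBox m n h).1) (posBox m n h).1 where
  word := [⟨1, Gen.cup⟩, ⟨2, Gen.box 0⟩, ⟨1, Gen.cap⟩]
  runs := by
    refine ⟨?_, ?_, ?_, ?_, ?_, ?_, ?_⟩ <;>
      simp [Runs, Gen.src, Gen.tgt, Gen.Fits, altSign] <;> omega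
  once := by intro j; simp [boxCount, Subsingleton.elim j 0]

/-- For a representation `E` of all pods whose restriction is identified with `R` by `φ`:
the map `a ↦ 1 ⊗ a` from the `-`-space of type `(m, n)` to the `+`-space of type
`(m + 1, n + 1)`. -/
def embNeg {K : Type u} [Field K] {E : RepAD.{u, v} K} {R : RepADPos.{u, v} K}
    (φ : E.restrict.Iso R) (m n : ℕ) (h : Even (m + n)) :
    E.V (negBox m n h) →ₗ[K] R.V (posBox m n h) :=
  (φ.equiv (posBox m n h)).toLinearMap ∘ₗ E.op (oneTensor m n h).pod

end AltPod

/-! Up to the factor d, a box X of sign `-` is a retract of the box `X.plus` that has one more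
upward string on the left. Opening places that string beside X; closing joins the leftmost pins of
`X.plus` by an arc on the left. Closing after opening leaves X with a loop beside it, and this loop
is anticlockwise because the region to the left of X is negative, so the composite acts as d
(`close_open`). Opening after closing is 1 ⊗ C. As d ≠ 0, in every extension opening is injective
and d⁻¹π_{1⊗C} projects onto its image, which forces both the spaces and the action.

Existence: the space at X consists of the fixed vectors of `plusProj`. A pod T acts through
`T.plus`, where negative inner boxes are closed and the outer box is opened, divided by d once for
each negative inner box. Plugging the pods `(S j).plus` into `T.plus` gives `(T.plug S).plus` with
one extra loop for each negative inner box of T (`act_plus_plug`), and the normalization absorbs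
these loops (`extAct_plug`). The identity pod acts by `plusProj`, which is trivial on fixed vectors.

Uniqueness: in any extension the opening map `embPlus` carries the action to this same formula
(`embPlus_act`) and has the fixed space as its image (`range_embPlus`); its inverse is the
comparison. A compatible isomorphism commutes with the opening maps, hence is determined by them.

Diagrams are words, and nearly all identities between composites hold as equalities of words. The
one isotopy applied by hand slides a loop past the contents of a box (`act_fill_loopWord`). -/

namespace AltPod

universe u v

/-! ### Substitution of words into inner boxes -/

section words

variable {k l : ℕ}

/-- Replace every layer consisting of the inner box `j` by the word `W j`. -/
def sub (W : Fin k → List (Layer l)) (w : List (Layer k)) : List (Layer l) :=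
  w.flatMap fun L => match L.gen with
    | .cup => [⟨L.pos, Gen.cup⟩]
    | .cap => [⟨L.pos, Gen.cap⟩]
    | .box j => shift L.pos (W j)

@[simp] theorem sub_nil (W : Fin k → List (Layer l)) : sub W [] = [] := rfl

@[simp] theorem sub_cons_cup (W : Fin k → List (Layer l)) (p : ℕ) (w : List (Layer k)) :
    sub W (⟨p, Gen.cup⟩ :: w) = ⟨p, Gen.cup⟩ :: sub W w := rfl

@[simp] theorem sub_cons_cap (W : Fin k → List (Layer l)) (p : ℕ) (w : List (Layer k)) :
    sub W (⟨p, Gen.cap⟩ :: w) = ⟨p, Gen.cap⟩ :: sub W w := rfl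

@[simp] theorem sub_cons_box (W : Fin k → List (Layer l)) (p : ℕ) (j : Fin k)
    (w : List (Layer k)) : sub W (⟨p, Gen.box j⟩ :: w) = shift p (W j) ++ sub W w := rfl

theorem sub_append (W : Fin k → List (Layer l)) (u v : List (Layer k)) :
    sub W (u ++ v) = sub W u ++ sub W v := List.flatMap_append

@[simp] theorem shift_nil (p : ℕ) : shift p ([] : List (Layer k)) = [] := rfl

@[simp] theorem shift_cons (p q : ℕ) (g : Gen k) (w : List (Layer k)) :
    shift p (⟨q, g⟩ :: w) = ⟨p + q, g⟩ :: shift p w := rfl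

@[simp] theorem shift_zero (w : List (Layer k)) : shift 0 w = w := by
  simp [shift]

theorem sub_shift (W : Fin k → List (Layer l)) (p : ℕ) :
    ∀ w : List (Layer k), sub W (shift p w) = shift p (sub W w)
  | [] => rfl
  | ⟨q, .cup⟩ :: w => by simp [sub_shift W p w]
  | ⟨q, .cap⟩ :: w => by simp [sub_shift W p w]
  | ⟨q, .box j⟩ :: w => by simp [sub_shift W p w, shift_append, shift_shift]

/-- Associativity of substitution. Plugging, relabelling and closing are all substitutions, so this
reduces comparisons of composite diagrams to comparisons of the contents of each box. -/
theorem sub_sub {m : ℕ} (W : Fin l → List (Layer m)) (V : Fin k → List (Layer l)) :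
    ∀ w : List (Layer k), sub W (sub V w) = sub (fun j => sub W (V j)) w
  | [] => rfl
  | ⟨q, .cup⟩ :: w => by simp [sub_sub W V w]
  | ⟨q, .cap⟩ :: w => by simp [sub_sub W V w]
  | ⟨q, .box j⟩ :: w => by simp [sub_sub W V w, sub_append, sub_shift]

theorem sub_box (w : List (Layer k)) : sub (fun j => [⟨0, Gen.box j⟩]) w = w := by
  induction w with
  | nil => rfl
  | cons L w ih => obtain ⟨p, _ | _ | j⟩ := L <;> simp [ih]

theorem sub_cups (W : Fin k → List (Layer l)) (p m : ℕ) : sub W (cups p m) = cups p m := by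
  simp only [sub, cups, List.flatMap_map]
  induction List.range m with
  | nil => rfl
  | cons a l ih => simp only [List.flatMap_cons, ih]; rfl

theorem sub_caps (W : Fin k → List (Layer l)) (p m : ℕ) : sub W (caps p m) = caps p m := by
  simp only [sub, caps, List.flatMap_map]
  induction (List.range m).reverse with
  | nil => rfl
  | cons a l ih => simp only [List.flatMap_cons, ih]; rfl

theorem relabel_shift (f : Fin k → Fin l) (p : ℕ) (w : List (Layer k)) :
    relabel f (shift p w) = shift p (relabel f w) := by
  simp [relabel, shift, Function.comp_def]

theorem relabel_eq_sub (f : Fin k → Fin l) (w : List (Layer k)) :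
    relabel f w = sub (fun j => [⟨0, Gen.box (f j)⟩]) w := by
  induction w with
  | nil => rfl
  | cons L w ih => obtain ⟨p, _ | _ | j⟩ := L <;> simp [← ih] <;> rfl

theorem plugWord_eq_sub {κ : Fin k → ℕ} (W : ∀ j, List (Layer (κ j))) (w : List (Layer k)) :
    plugWord W w = sub (fun j => relabel (fun i => finSigmaFinEquiv ⟨j, i⟩) (W j)) w := rfl

theorem sub_congr (W W' : Fin k → List (Layer l)) :
    ∀ w : List (Layer k), (∀ j, boxCount w j ≠ 0 → W j = W' j) → sub W w = sub W' w
  | [], _ => rfl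
  | ⟨p, g⟩ :: w, h => by
      have ih := sub_congr W W' w fun j hj => h j (by
        rw [← List.singleton_append, boxCount_append]; omega)
      obtain _ | _ | j := g
      · simp [ih]
      · simp [ih]
      · rw [sub_cons_box, sub_cons_box, ih, h j (by simp [boxCount])]

theorem boxCount_shift (p : ℕ) (w : List (Layer k)) (j : Fin k) :
    boxCount (shift p w) j = boxCount w j := by
  simp [boxCount, shift, List.countP_map, Function.comp_def]

theorem boxCount_sub (W : Fin k → List (Layer l)) (i : Fin l) :
    ∀ w : List (Layer k), boxCount (sub W w) i = ∑ j, boxCount w j * boxCount (W j) i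
  | [] => by simp [boxCount]
  | ⟨p, g⟩ :: w => by
      have ih := boxCount_sub W i w
      have e : ∀ j, boxCount (⟨p, g⟩ :: w) j = boxCount [⟨p, g⟩] j + boxCount w j :=
        fun j => boxCount_append [_] w j
      simp only [e, add_mul, Finset.sum_add_distrib, ← ih]
      have e' : sub W (⟨p, g⟩ :: w) = sub W [⟨p, g⟩] ++ sub W w := sub_append W [_] w
      rw [e', boxCount_append]
      congr 1
      obtain _ | _ | j := g
      · simp [boxCount]
      · simp [boxCount]
      · rw [sub_cons_box, sub_nil, List.append_nil, boxCount_shift,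
          Finset.sum_eq_single j]
        · simp [boxCount]
        · intro j' _ hj'
          simp [boxCount, hj'.symm]
        · simp

theorem runs_append_iff {X : Fin k → Box} {ε : Bool} (v : List (Layer k)) :
    ∀ (u : List (Layer k)) (m l : ℕ), Runs X ε m (u ++ v) l ↔
      ∃ n, Runs X ε m u n ∧ Runs X ε n v l
  | [], m, l => by simp [Runs]
  | L :: u, m, l => by
      simp only [Runs, List.cons_append, runs_append_iff v u]
      constructor
      · rintro ⟨h1, h2, n, h3, h4⟩; exact ⟨n, ⟨h1, h2, h3⟩, h4⟩
      · rintro ⟨n, ⟨h1, h2, h3⟩, h4⟩; exact ⟨h1, h2, n, h3, h4⟩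

/-- The words `W j` can be put into the inner boxes `X j`, and every box `X' i` occurs in
exactly one of them, once. -/
structure IsFilling (X : Fin k → Box) (X' : Fin l → Box) (W : Fin k → List (Layer l)) :
    Prop where
  runs : ∀ j, Runs X' (X j).sign (X j).lower (W j) (X j).upper
  once : ∀ i, ∑ j, boxCount (W j) i = 1

theorem runs_sub {X : Fin k → Box} {X' : Fin l → Box} {W : Fin k → List (Layer l)}
    (hW : ∀ j, Runs X' (X j).sign (X j).lower (W j) (X j).upper) {ε : Bool} :
    ∀ (w : List (Layer k)) (m n : ℕ), Runs X ε m w n → Runs X' ε m (sub W w) n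
  | [], m, n, h => h
  | ⟨p, g⟩ :: w, m, n, h => by
      simp only [Runs] at h
      obtain ⟨h1, h2, h3⟩ := h
      have ih := runs_sub hW w _ _ h3
      cases g with
      | cup => exact ⟨h1, h2, ih⟩
      | cap => exact ⟨h1, h2, ih⟩
      | box j =>
        refine runs_append _ _ _ _ _ ?_ ih
        simp only [Gen.src, Gen.tgt, Gen.Fits] at h1 h2 ⊢
        have hj := hW j
        rw [h2] at hj
        have := runs_shift p (m - (p + (X j).lower)) _ _ _ hj
        have e1 : p + (X j).lower + (m - (p + (X j).lower)) = m := by omega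
        have e2 : p + (X j).upper + (m - (p + (X j).lower))
            = m - (X j).lower + (X j).upper := by omega
        rw [e1, e2] at this
        exact this

/-- Snakes contain no boxes, while slides and turns are available for arbitrary subdiagrams, so
every elementary isotopy survives substitution. -/
theorem Move.sub {X : Fin k → Box} {X' : Fin l → Box} {W : Fin k → List (Layer l)}
    (hW : ∀ j, Runs X' (X j).sign (X j).lower (W j) (X j).upper)
    {x y : List (Layer k)} (h : Move X x y) : Move X' (AltPod.sub W x) (AltPod.sub W y) := by
  cases h with
  | slide ε A B p m n r hA =>
    simp only [sub_append, sub_shift]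
    exact Move.slide ε _ _ p m n r (runs_sub hW _ _ _ hA)
  | snake_left p => exact Move.snake_left p
  | snake_right p => exact Move.snake_right p
  | turn ε A p m n hA =>
    simp only [sub_append, sub_shift, sub_cups, sub_caps]
    exact Move.turn ε _ p m n (runs_sub hW _ _ _ hA)

@[ext] theorem Diagram.ext {X : Fin k → Box} {Y : Box} {D D' : Diagram X Y}
    (h : D.word = D'.word) : D = D' := by
  cases D; cases D'; cases h; rfl

/-- Substitution of words into the inner boxes of a diagram. -/
def Diagram.fill {X : Fin k → Box} {X' : Fin l → Box} {Y : Box} (D : Diagram X Y)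
    (W : Fin k → List (Layer l)) (hW : IsFilling X X' W) : Diagram X' Y where
  word := sub W D.word
  runs := runs_sub hW.runs _ _ _ D.runs
  once i := by simp [boxCount_sub, D.once, hW.once]

end words

/-! ### Opening and closing the leftmost string -/

/-- The number of strings to be added on the left of a box to make its sign `+`. -/
def Box.offset (X : Box) : ℕ := (!X.sign).toNat

/-- The box with sign `+` obtained by adding, if necessary, an upward string on the left. -/
def Box.plus : Box → PosBox
  | ⟨true, m, n, h⟩ => ⟨⟨true, m, n, h⟩, rfl⟩
  | ⟨false, m, n, h⟩ => posBox m n h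

theorem Box.plus_val : ∀ X : PosBox, X.1.plus = X
  | ⟨⟨true, _, _, _⟩, _⟩ => rfl

theorem Box.plus_lower : ∀ X : Box, X.plus.1.lower = X.offset + X.lower
  | ⟨true, m, n, h⟩ => by simp [plus, offset]
  | ⟨false, m, n, h⟩ => by simp [plus, offset, add_comm]

theorem Box.plus_upper : ∀ X : Box, X.plus.1.upper = X.offset + X.upper
  | ⟨true, m, n, h⟩ => by simp [plus, offset]
  | ⟨false, m, n, h⟩ => by simp [plus, offset, add_comm]

theorem Box.altSign_offset (X : Box) : altSign true X.offset = X.sign := by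
  obtain ⟨_ | _, m, n, h⟩ := X <;> simp [offset, altSign]

theorem Box.altSign_plus (X : Box) (p : ℕ) :
    altSign X.plus.1.sign (X.offset + p) = altSign X.sign p := by
  rw [altSign_add, X.plus.2, X.altSign_offset]

/-- The inner box with sign `+`, with its leftmost pins joined by an arc on its left if `X` has
sign `-`. -/
def closeWord {k : ℕ} (X : Box) (j : Fin k) : List (Layer k) :=
  bif X.sign then [⟨0, Gen.box j⟩] else [⟨0, Gen.cup⟩, ⟨1, Gen.box j⟩, ⟨0, Gen.cap⟩]

section plus

variable {k : ℕ} {X : Fin k → Box} {Y : Box}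

theorem boxCount_closeWord (X : Box) (j i : Fin k) :
    boxCount (closeWord X j) i = if j = i then 1 else 0 := by
  obtain ⟨_ | _, m, n, h⟩ := X <;> by_cases hj : j = i <;> simp [closeWord, boxCount, hj]

theorem runs_closeWord {X' : Fin k → Box} :
    ∀ (X : Box) (j : Fin k), X' j = X.plus.1 → Runs X' X.sign X.lower (closeWord X j) X.upper
  | ⟨true, m, n, h⟩, j, hj => by
      simp [closeWord, Runs, Gen.src, Gen.tgt, Gen.Fits, hj, Box.plus, altSign]
  | ⟨false, m, n, h⟩, j, hj => by
      simp [closeWord, Runs, Gen.src, Gen.tgt, Gen.Fits, hj, Box.plus, altSign]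
      omega

theorem isFilling_closeWord (X : Fin k → Box) :
    IsFilling X (fun j => (X j).plus.1) fun j => closeWord (X j) j where
  runs j := runs_closeWord (X j) j rfl
  once i := by simp [boxCount_closeWord]

theorem runs_offset {w : List (Layer k)} (h : Runs X Y.sign Y.lower w Y.upper) :
    Runs X Y.plus.1.sign Y.plus.1.lower (shift Y.offset w) Y.plus.1.upper := by
  rw [Y.plus_lower, Y.plus_upper]
  refine runs_shift _ 0 _ _ _ ?_
  rwa [Y.plus.2, Y.altSign_offset]

/-- Add strings on the left of a diagram, to make its sign `+`. -/
def Diagram.openLeft (D : Diagram X Y) : Diagram X Y.plus.1 where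
  word := shift Y.offset D.word
  runs := runs_offset D.runs
  once i := by rw [boxCount_shift, D.once]

/-- The diagram between boxes of sign `+` obtained by closing the leftmost strings of the inner
boxes of sign `-` and adding, if necessary, a string on the left. -/
def Diagram.plus (D : Diagram X Y) : Diagram (fun j => (X j).plus.1) Y.plus.1 :=
  (D.fill _ (isFilling_closeWord X)).openLeft

theorem Diagram.plus_word (D : Diagram X Y) :
    D.plus.word = shift Y.offset (sub (fun j => closeWord (X j) j) D.word) := rfl

theorem Step.plus {D D' : Diagram X Y} (h : Step D D') : Step D.plus D'.plus := by
  obtain ⟨a, x, y, b, h1, h2, hm⟩ := h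
  refine ⟨shift Y.offset (sub (fun j => closeWord (X j) j) a), _, _,
    shift Y.offset (sub (fun j => closeWord (X j) j) b), ?_, ?_,
    (hm.sub (isFilling_closeWord X).runs).shift Y.offset⟩
  · simp only [Diagram.plus_word, h1, sub_append, shift_append]
  · simp only [Diagram.plus_word, h2, sub_append, shift_append]

/-- `Diagram.plus` on isotopy classes. -/
def Pod.plus (T : Pod X Y) : Pod (fun j => (X j).plus.1) Y.plus.1 :=
  Quot.map Diagram.plus (fun _ _ => Step.plus) T

/-- An added outer string changes the position of the loop but not the sign of its region
(`Box.altSign_plus`), so the loop stays anticlockwise. -/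
theorem AddsLoop.plus {D D₀ : Diagram X Y} (h : AddsLoop D D₀) : AddsLoop D.plus D₀.plus := by
  obtain ⟨a, b, p, h1, h2, h3⟩ := h
  refine ⟨shift Y.offset (sub (fun j => closeWord (X j) j) a),
    shift Y.offset (sub (fun j => closeWord (X j) j) b), Y.offset + p, ?_, ?_, ?_⟩
  · simp [Diagram.plus_word, h1, sub_append, shift_append]
  · simp [Diagram.plus_word, h2, sub_append, shift_append]
  · rw [Y.altSign_plus, h3]

/-- The inner box `X`, with an upward string on its left if `X` has sign `-`. -/
def openBox (X : Box) : Diagram (fun _ : Fin 1 => X) X.plus.1 := (Diagram.id X).openLeft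

/-- The inner box `X.plus`, with its leftmost pins joined by an arc if `X` has sign `-`. -/
def closeBox (X : Box) : Diagram (fun _ : Fin 1 => X.plus.1) X :=
  (Diagram.id X).fill _ (isFilling_closeWord _)

theorem openBox_word (X : Box) : (openBox X).word = [⟨X.offset, Gen.box 0⟩] := rfl

theorem closeBox_word (X : Box) : (closeBox X).word = closeWord X 0 := by
  simp [closeBox, Diagram.fill, Diagram.id]

end plus

/-! ### Removing loops on the left of inner boxes -/

section loops

variable {k l : ℕ} {X : Fin k → Box} {X' : Fin l → Box} {W W' : Fin k → List (Layer l)}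

/-- A word with a loop on its left, which extends below and above it. -/
def loopWord (w : List (Layer k)) : List (Layer k) :=
  ⟨0, Gen.cup⟩ :: (shift 2 w ++ [⟨0, Gen.cap⟩])

/-- Crossing the two strands of the loop restores the sign, so the contents still fit. -/
theorem runs_loopWord {ε : Bool} {m n : ℕ} {w : List (Layer k)} (h : Runs X ε m w n) :
    Runs X ε m (loopWord w) n := by
  have h' : Runs X (altSign ε 2) m w n := by simpa [altSign] using h
  have := runs_shift 2 0 _ _ _ h'
  refine ⟨by simp [Gen.src], trivial, ?_⟩
  simp only [Gen.src, Gen.tgt, Nat.sub_zero]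
  refine runs_append _ _ _ (n + 2) _ ?_ ?_
  · simpa [add_comm] using this
  · simp [Runs, Gen.src, Gen.tgt, Gen.Fits]

theorem runs_loop_append {ε : Bool} {m n : ℕ} {w : List (Layer k)} (h : Runs X ε m w n) :
    Runs X ε m (⟨0, Gen.cup⟩ :: ⟨0, Gen.cap⟩ :: w) n := by
  simpa [Runs, Gen.src, Gen.tgt, Gen.Fits] using h

theorem boxCount_loopWord (w : List (Layer k)) (i : Fin k) :
    boxCount (loopWord w) i = boxCount w i := by
  rw [← boxCount_shift 2 w]
  simp [boxCount, loopWord]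

/-- The third alternative, a loop detached below the word, is the intermediate stage in
`act_fill_loopWord`. -/
theorem IsFilling.add_loops (hW : IsFilling X X' W)
    (h : ∀ j, W' j = W j ∨ W' j = loopWord (W j) ∨
      W' j = ⟨0, Gen.cup⟩ :: ⟨0, Gen.cap⟩ :: W j) : IsFilling X X' W' where
  runs j := by
    obtain h | h | h := h j <;> rw [h]
    · exact hW.runs j
    · exact runs_loopWord (hW.runs j)
    · exact runs_loop_append (hW.runs j)
  once i := by
    rw [← hW.once i]
    refine Finset.sum_congr rfl fun j _ => ?_
    obtain h | h | h := h j <;> rw [h]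
    · exact boxCount_loopWord _ _
    · simp [boxCount]

/-- The sign condition comes from the fit of the box layer; it is what makes a loop beside a
negative box anticlockwise. -/
theorem Diagram.exists_box {Y : Box} (D : Diagram X Y) (j : Fin k) :
    ∃ a p b, D.word = a ++ ⟨p, Gen.box j⟩ :: b ∧ boxCount a j = 0 ∧ boxCount b j = 0 ∧
      altSign Y.sign p = (X j).sign := by
  have hD := D.once j
  have hmem : ∃ L ∈ D.word, L.gen = Gen.box j := by
    have : 0 < boxCount D.word j := by omega
    simpa [boxCount, List.countP_pos_iff] using this
  obtain ⟨⟨p, g⟩, hL, hg⟩ := hmem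
  obtain ⟨a, b, hab⟩ := List.append_of_mem hL
  simp only at hg
  subst hg
  have hr := D.runs
  rw [hab, ← List.singleton_append, boxCount_append, boxCount_append] at hD
  rw [hab, runs_append_iff] at hr
  obtain ⟨n, -, -, hfit, -⟩ := hr
  have h1 : boxCount [(⟨p, Gen.box j⟩ : Layer k)] j = 1 := by simp [boxCount]
  exact ⟨a, p, b, hab, by omega, by omega, hfit.symm⟩

variable {K : Type u} [Field K] {O : Type} {o : O → Box} {R : Rep.{u, v} K o} {d : K}

/-- The loop is as tall as the contents of the box. Once its maximum is slid down below them, it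
bounds an empty disk and can be removed. -/
theorem act_fill_loopWord (hR : R.LoopsEq d) {Z : Fin l → O} {Y : O} (D : Diagram X (o Y))
    (hW : IsFilling X (fun i => o (Z i)) W) (hW' : IsFilling X (fun i => o (Z i)) W')
    (j : Fin k) (hj : (X j).sign = false) (hl : W' j = loopWord (W j))
    (hne : ∀ i, i ≠ j → W' i = W i) :
    R.act (D.fill W' hW').pod = d • R.act (D.fill W hW).pod := by
  have hV : IsFilling X (fun i => o (Z i))
      (Function.update W j (⟨0, Gen.cup⟩ :: ⟨0, Gen.cap⟩ :: W j)) := by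
    refine hW.add_loops fun i => ?_
    by_cases hi : i = j
    · subst hi; simp
    · simp [hi]
  obtain ⟨a, p, b, hD, ha, hb, hp⟩ := D.exists_box j
  have e : ∀ V : Fin k → List (Layer l), (∀ i, i ≠ j → V i = W i) →
      sub V D.word = sub W a ++ (shift p (V j) ++ sub W b) := by
    intro V hV
    rw [hD, sub_append, sub_cons_box, sub_congr V W a, sub_congr V W b]
    · rintro i hi; exact hV i (by rintro rfl; exact hi hb)
    · rintro i hi; exact hV i (by rintro rfl; exact hi ha)
  have h1 : (D.fill _ hV).pod = (D.fill W' hW').pod := by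
    -- The cap, with two strands in and none out, slides past `W j` with no strand between them. A
    -- cap fits in either sign, so `true` is an arbitrary choice.
    refine Quot.sound ⟨sub W a ++ [⟨p, Gen.cup⟩], _, _, sub W b, ?_, ?_,
      Move.slide true [⟨0, Gen.cap⟩] (W j) p 2 0 0 ?_⟩
    · refine (e _ fun i hi => by simp [hi]).trans ?_
      simp
    · refine (e _ hne).trans ?_
      simp [hl, loopWord, shift_append, shift_shift]
    · simp [Runs, Gen.src, Gen.tgt, Gen.Fits]
  rw [← h1]
  refine hR _ _ ⟨sub W a, shift p (W j) ++ sub W b, p, ?_, ?_, hp.trans hj⟩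
  · refine (e _ fun i hi => by simp [hi]).trans ?_
    simp
  · exact e _ fun _ _ => rfl

/-- Loops are inserted one box at a time, by induction on the set of boxes already treated; positive
boxes contribute d⁰. -/
theorem act_fill_loops (hR : R.LoopsEq d) {Z : Fin l → O} {Y : O} (D : Diagram X (o Y))
    (hW : IsFilling X (fun i => o (Z i)) W) (hW' : IsFilling X (fun i => o (Z i)) W')
    (h : ∀ j, W' j = bif (X j).sign then W j else loopWord (W j)) :
    R.act (D.fill W' hW').pod = (∏ j, d ^ (X j).offset) • R.act (D.fill W hW).pod := by
  have hF : ∀ s : Finset (Fin k),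
      IsFilling X (fun i => o (Z i)) fun j => if j ∈ s then W' j else W j := by
    refine fun s => hW.add_loops fun j => ?_
    by_cases hj : j ∈ s
    · cases hs : (X j).sign <;> simp [hj, h, hs]
    · simp [hj]
  have key : ∀ s : Finset (Fin k), R.act (D.fill _ (hF s)).pod
      = (∏ j ∈ s, d ^ (X j).offset) • R.act (D.fill W hW).pod := by
    intro s
    induction s using Finset.induction_on with
    | empty => simp
    | insert a s ha ih =>
      rw [Finset.prod_insert ha, mul_smul, ← ih]
      have hne : ∀ i, i ≠ a →
          (if i ∈ insert a s then W' i else W i) = if i ∈ s then W' i else W i := by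
        intro i hi; simp [hi]
      cases hs : (X a).sign
      · have ho : (X a).offset = 1 := by simp [Box.offset, hs]
        rw [ho, pow_one]
        exact act_fill_loopWord hR D _ _ a hs (by simp [ha, h, hs]) hne
      · have ho : (X a).offset = 0 := by simp [Box.offset, hs]
        rw [ho, pow_zero, one_smul]
        congr 3
        funext i
        by_cases hi : i = a
        · subst hi; simp [ha, h, hs]
        · exact hne i hi
  simpa using key Finset.univ

end loops

/-! ### Composition in a representation, computed on words -/

section comp

variable {K : Type u} [Field K] {O : Type} {o : O → Box} (R : Rep.{u, v} K o)

/-- Needed because the number of inner boxes after plugging is a sum that is only propositionally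
the expected number. -/
theorem act_reindex {k l : ℕ} (f : Fin k → Fin l) (hk : k = l) (hf : ∀ i, (f i : ℕ) = i)
    {X : Fin l → O} {Y : O} (D : Diagram (fun i => o (X (f i))) (o Y))
    (D' : Diagram (fun i => o (X i)) (o Y)) (hw : D'.word = relabel f D.word)
    (x : ∀ i, R.V (X i)) :
    R.act (X := fun i => X (f i)) D.pod (fun i => x (f i)) = R.act D'.pod x := by
  subst hk
  obtain rfl : f = fun i => i := funext fun i => Fin.ext (hf i)
  obtain rfl : D' = D := Diagram.ext (by rw [hw, relabel_eq_sub, sub_box])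
  rfl

/-- A form of `act_plug` with freely chosen index type: `g j` enumerates the block of inner boxes
that come from `E j`, in lexicographic order. -/
theorem act_comp {k l : ℕ} {κ : Fin k → ℕ} (g : ∀ j, Fin (κ j) → Fin l) (hl : ∑ j, κ j = l)
    (hg : ∀ j i, (g j i : ℕ) = finSigmaFinEquiv ⟨j, i⟩)
    {X : Fin k → O} {Y : O} {Z : Fin l → O} (D : Diagram (fun i => o (X i)) (o Y))
    (E : ∀ j, Diagram (fun i => o (Z (g j i))) (o (X j)))
    (F : Diagram (fun i => o (Z i)) (o Y))
    (hF : F.word = sub (fun j => relabel (g j) (E j).word) D.word) (x : ∀ i, R.V (Z i)) :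
    R.act F.pod x =
      R.act D.pod fun j => R.act (X := fun i => Z (g j i)) (E j).pod fun i => x (g j i) := by
  have h := R.act_plug (Z := fun j i => Z (g j i)) D.pod (fun j => (E j).pod)
    (fun j i => x (g j i))
  rw [← h]
  have hf : ∀ s, (g (finSigmaFinEquiv.symm s).1 (finSigmaFinEquiv.symm s).2 : ℕ) = s := by
    intro s; rw [hg, Sigma.eta, Equiv.apply_symm_apply]
  have h2 : Pod.plug D.pod (fun j => (E j).pod) = (D.plug E).pod := Pod.plug_pod D E
  rw [h2]
  refine (act_reindex R _ hl hf (D.plug E) F ?_ x).symm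
  rw [hF]
  have hr : ∀ j i, g (finSigmaFinEquiv.symm (finSigmaFinEquiv (⟨j, i⟩ : Σ j, Fin (κ j)))).1
      (finSigmaFinEquiv.symm (finSigmaFinEquiv (⟨j, i⟩ : Σ j, Fin (κ j)))).2 = g j i :=
    fun j i => Fin.ext ((hf _).trans (hg j i).symm)
  simp only [Diagram.plug, plugWord_eq_sub, relabel_eq_sub, sub_sub, sub_cons_box, shift_zero,
    sub_nil, List.append_nil, hr]

/-- Composition with a diagram with one inner box. -/
theorem op_act {k : ℕ} {X : Fin k → O} {Y Y' : O} (D : Diagram (fun _ : Fin 1 => o Y) (o Y'))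
    (E : Diagram (fun i => o (X i)) (o Y)) (F : Diagram (fun i => o (X i)) (o Y'))
    (hF : F.word = sub (fun _ => E.word) D.word) (x : ∀ i, R.V (X i)) :
    R.op D.pod (R.act E.pod x) = R.act F.pod x := by
  refine (act_comp R (k := 1) (κ := fun _ => k) (X := fun _ => Y) (fun _ i => i) (by simp) ?_ D
    (fun _ => E) F ?_ x).symm
  · intro j i
    rw [Subsingleton.elim j 0]
    simp [finSigmaFinEquiv_apply]
  · rw [hF]; congr; funext j; rw [relabel_eq_sub, sub_box]

/-- Precomposition with diagrams with one inner box. -/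
theorem act_op {k : ℕ} {X Z : Fin k → O} {Y : O} (D : Diagram (fun i => o (X i)) (o Y))
    (E : ∀ j, Diagram (fun _ : Fin 1 => o (Z j)) (o (X j))) (F : Diagram (fun i => o (Z i)) (o Y))
    (hF : F.word = sub (fun j => relabel (fun _ => j) (E j).word) D.word) (x : ∀ i, R.V (Z i)) :
    R.act D.pod (fun j => R.op (E j).pod (x j)) = R.act F.pod x := by
  refine (act_comp R (κ := fun _ => 1) (fun j _ => j) (by simp) ?_ D E F hF x).symm
  intro j i
  simp [finSigmaFinEquiv_apply]

theorem op_id (Y : O) (x : R.V Y) : R.op (Pod.id (o Y)) x = x := R.act_id Y fun _ => x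

end comp

/-! ### Plugging and `Diagram.plus` -/

section plug

/-- The closing arc meets the string that opening put on the left of `A`, and together they form a
loop. Every power of d in the argument arises here. -/
theorem sub_closeWord {k l : ℕ} (V : Fin k → List (Layer l)) (X : Box) (j : Fin k)
    (A : List (Layer l)) (hV : V j = shift X.offset A) :
    sub V (closeWord X j) = bif X.sign then A else loopWord A := by
  obtain ⟨_ | _, m, n, h⟩ := X
  · simp [closeWord, loopWord, hV, Box.offset, shift_shift]
  · simp [closeWord, hV, Box.offset]

theorem relabel_closeWord {k l : ℕ} (f : Fin k → Fin l) (X : Box) (j : Fin k) :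
    relabel f (closeWord X j) = closeWord X (f j) := by
  obtain ⟨_ | _, m, n, h⟩ := X <;> rfl

theorem IsFilling.sub {k l m : ℕ} {X : Fin k → Box} {X' : Fin l → Box} {X'' : Fin m → Box}
    {V : Fin k → List (Layer l)} {U : Fin l → List (Layer m)} (hV : IsFilling X X' V)
    (hU : IsFilling X' X'' U) : IsFilling X X'' fun j => AltPod.sub U (V j) where
  runs j := runs_sub hU.runs _ _ _ (hV.runs j)
  once i := by
    simp only [boxCount_sub]
    rw [Finset.sum_comm]
    simp only [← Finset.sum_mul, hV.once, one_mul, hU.once]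

variable {k : ℕ} {κ : Fin k → ℕ} {X : Fin k → Box} {Y : Box} {Z : ∀ j, Fin (κ j) → Box}

theorem isFilling_plug (S : ∀ j, Diagram (Z j) (X j)) : IsFilling X (plugBoxes Z)
    fun j => relabel (fun i => finSigmaFinEquiv ⟨j, i⟩) (S j).word where
  runs j := runs_relabel _ (fun i => plugBoxes_apply Z j i) _ _ _ (S j).runs
  once s := by
    obtain ⟨⟨j, i⟩, rfl⟩ := finSigmaFinEquiv.surjective s
    have h : ∀ j', boxCount (relabel (fun i => finSigmaFinEquiv ⟨j', i⟩) (S j').word)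
        (finSigmaFinEquiv ⟨j, i⟩) = if j' = j then 1 else 0 := by
      intro j'
      have := boxCount_plugLayer (fun j => (S j).word) ⟨0, Gen.box j'⟩ j i
      rw [(S j).once, mul_one] at this
      simp only [plugLayer, shift_zero] at this
      rw [this]
      by_cases hj : j' = j <;> simp [boxCount, hj]
    simp [h]

/-- Making all boxes of a composite positive creates a loop for every box of sign `-` at which
diagrams are plugged in. -/
theorem act_plus_plug {K : Type u} [Field K] {R : RepADPos.{u, v} K} {d : K} (hR : R.LoopsEq d)
    (T : Diagram X Y) (S : ∀ j, Diagram (Z j) (X j)) :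
    R.act (X := plugBoxes fun j i => (Z j i).plus) (Y := Y.plus)
        (T.plus.plug fun j => (S j).plus).pod
      = (∏ j, d ^ (X j).offset) •
        R.act (X := fun s => (plugBoxes Z s).plus) (T.plug S).plus.pod := by
  have hW := (isFilling_plug S).sub (isFilling_closeWord (plugBoxes Z))
  have hW' : IsFilling X (fun s => (plugBoxes Z s).plus.1) fun j => bif (X j).sign
      then sub (fun s => closeWord (plugBoxes Z s) s)
        (relabel (fun i => finSigmaFinEquiv ⟨j, i⟩) (S j).word)
      else loopWord (sub (fun s => closeWord (plugBoxes Z s) s)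
        (relabel (fun i => finSigmaFinEquiv ⟨j, i⟩) (S j).word)) :=
    hW.add_loops fun j => by cases (X j).sign <;> simp
  -- Both composites are fillings of the single diagram `T.openLeft`, and their contents differ only
  -- by loops at the negative boxes.
  have h := act_fill_loops (Z := fun s => (plugBoxes Z s).plus) (Y := Y.plus) hR
    T.openLeft hW hW' fun _ => rfl
  have e1 : T.openLeft.fill _ hW = (T.plug S).plus := by
    ext1
    simp only [Diagram.fill, Diagram.openLeft, Diagram.plus_word, Diagram.plug, plugWord_eq_sub,
      sub_shift, sub_sub]
  have e2 : T.openLeft.fill _ hW' = T.plus.plug fun j => (S j).plus := by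
    ext1
    simp only [Diagram.fill, Diagram.openLeft, Diagram.plus_word, Diagram.plug, plugWord_eq_sub,
      sub_shift, sub_sub]
    congr 2
    funext j
    refine (sub_closeWord _ _ _ _ ?_).symm
    rw [relabel_shift]
    congr 1
    simp only [relabel_eq_sub, sub_sub]
    congr 1
    funext i
    rw [← relabel_eq_sub, relabel_closeWord, sub_cons_box, shift_zero, sub_nil, List.append_nil,
      plugBoxes_apply]
  rw [e1, e2] at h
  exact h

end plug

/-! ### The extension, realized on fixed vectors of the projections -/

section ext

variable {K : Type u} [Field K] {R : RepADPos.{u, v} K} {d : K}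

/-- If `Y` is negative, the arc in `(Diagram.id Y).plus` closes up the leftmost string of `T.plus`,
and a new string appears to its left: the result is `T.plus` with one loop. -/
theorem op_plus_id_act (hR : R.LoopsEq d) {k : ℕ} {X : Fin k → Box} {Y : Box}
    (T : Diagram X Y) (x : ∀ j, R.V (X j).plus) :
    R.op (X := Y.plus) (Y := Y.plus) (Diagram.id Y).plus.pod
        (R.act (X := fun j => (X j).plus) T.plus.pod x)
      = d ^ Y.offset • R.act (X := fun j => (X j).plus) T.plus.pod x := by
  have hW : IsFilling (fun _ : Fin 1 => Y) (fun j => (X j).plus.1)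
      fun _ => (T.fill _ (isFilling_closeWord X)).word :=
    ⟨fun _ => (T.fill _ (isFilling_closeWord X)).runs, fun i => by
      simpa using (T.fill _ (isFilling_closeWord X)).once i⟩
  have hW' : IsFilling (fun _ : Fin 1 => Y) (fun j => (X j).plus.1) fun _ => bif Y.sign
      then (T.fill _ (isFilling_closeWord X)).word
      else loopWord (T.fill _ (isFilling_closeWord X)).word :=
    hW.add_loops fun j => by cases Y.sign <;> simp
  have h := act_fill_loops (Z := fun j => (X j).plus) (Y := Y.plus) hR
    (openBox Y) hW hW' fun _ => rfl
  have e1 : (openBox Y).fill _ hW = T.plus := by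
    ext1
    simp [Diagram.fill, openBox_word, Diagram.plus_word]
  rw [e1] at h
  rw [op_act R _ _ ((openBox Y).fill _ hW'), h]
  · simp
  · simp only [Diagram.fill, openBox_word, Diagram.plus_word, Diagram.id, sub_cons_box, sub_nil,
      List.append_nil, shift_zero, sub_shift]
    rw [sub_closeWord _ _ _ _ rfl]

variable (R d) in
/-- The projection `d⁻¹ π_{1 ⊗ C}` for boxes of sign `-`; the identity for boxes of sign `+`. -/
noncomputable def plusProj (X : Box) : R.V X.plus →ₗ[K] R.V X.plus :=
  (d ^ X.offset)⁻¹ • R.op (X := X.plus) (Y := X.plus) (Diagram.id X).plus.pod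

/-- Makes the action land in the fixed spaces; applied to the identity pod it gives the idempotence
of `plusProj`. -/
theorem plusProj_act (hd : d ≠ 0) (hR : R.LoopsEq d) {k : ℕ} {X : Fin k → Box} {Y : Box}
    (T : Pod X Y) (x : ∀ j, R.V (X j).plus) :
    plusProj R d Y (R.act (X := fun j => (X j).plus) T.plus x)
      = R.act (X := fun j => (X j).plus) T.plus x := by
  induction T using Quot.ind with
  | mk T =>
    have h := op_plus_id_act hR T x
    refine (congrArg ((d ^ Y.offset)⁻¹ • ·) h).trans ?_
    exact inv_smul_smul₀ (pow_ne_zero _ hd) _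

variable (R d) in
/-- The space of the extended representation at the box `X`. -/
noncomputable def extSpace (X : Box) : Submodule K (R.V X.plus) := LinearMap.eqLocus (plusProj R d X) .id

theorem mem_extSpace {X : Box} {x : R.V X.plus} : x ∈ extSpace R d X ↔ plusProj R d X x = x :=
  Iff.rfl

/-- The action of a pod on the extended representation. -/
noncomputable def extAct (hd : d ≠ 0) (hR : R.LoopsEq d) {k : ℕ} {X : Fin k → Box} {Y : Box}
    (T : Pod X Y) : MultilinearMap K (fun i => extSpace R d (X i)) (extSpace R d Y) :=
  MultilinearMap.codRestrict ((∏ j, d ^ (X j).offset)⁻¹ •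
      (R.act (X := fun j => (X j).plus) (Y := Y.plus) T.plus).compLinearMap
        fun i => (extSpace R d (X i)).subtype) (extSpace R d Y) fun _ =>
    Submodule.smul_mem _ _ (plusProj_act hd hR T _)

theorem extAct_coe (hd : d ≠ 0) (hR : R.LoopsEq d) {k : ℕ} {X : Fin k → Box} {Y : Box}
    (T : Pod X Y) (x : ∀ i, extSpace R d (X i)) :
    (extAct hd hR T x : R.V Y.plus) = (∏ j, d ^ (X j).offset)⁻¹ •
      R.act (X := fun j => (X j).plus) (Y := Y.plus) T.plus fun i => (x i : R.V (X i).plus) :=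
  rfl

/-- Both sides carry d⁻¹ for each negative `Z j i`. The right side has in addition d⁻¹ for each
negative `X j`, which cancels the loop at that box. -/
theorem extAct_plug (hd : d ≠ 0) (hR : R.LoopsEq d) {k : ℕ} {κ : Fin k → ℕ} {X : Fin k → Box}
    {Y : Box} {Z : ∀ j, Fin (κ j) → Box} (T : Pod X Y) (S : ∀ j, Pod (Z j) (X j))
    (x : ∀ j i, extSpace R d (Z j i)) :
    extAct hd hR (X := plugBoxes Z) (T.plug S)
        (fun s => x (finSigmaFinEquiv.symm s).1 (finSigmaFinEquiv.symm s).2)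
      = extAct hd hR T fun j => extAct hd hR (S j) (x j) := by
  obtain ⟨T, rfl⟩ : ∃ D : Diagram X Y, T = D.pod := ⟨_, (Quot.out_eq T).symm⟩
  obtain ⟨S, rfl⟩ : ∃ E : ∀ j, Diagram (Z j) (X j), S = fun j => (E j).pod :=
    ⟨_, funext fun j => (Quot.out_eq (S j)).symm⟩
  rw [Pod.plug_pod]
  apply Subtype.ext
  simp only [extAct_coe]
  have h1 := R.act_plug (X := fun j => (X j).plus) (Y := Y.plus) (Z := fun j i => (Z j i).plus)
    T.plus.pod (fun j => (S j).plus.pod) fun j i => (x j i : R.V (Z j i).plus)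
  have h2 : Pod.plug T.plus.pod (fun j => (S j).plus.pod)
      = (T.plus.plug fun j => (S j).plus).pod := Pod.plug_pod _ _
  rw [h2, act_plus_plug hR T S] at h1
  rw [MultilinearMap.map_smul_univ]
  refine Eq.trans ?_ (congrArg (fun y => (∏ j, d ^ (X j).offset)⁻¹ •
    (∏ j, (∏ i, d ^ (Z j i).offset)⁻¹) • y) h1)
  rw [smul_apply, smul_comm (∏ j, (∏ i, d ^ (Z j i).offset)⁻¹), inv_smul_smul₀
    (Finset.prod_ne_zero_iff.2 fun j _ => pow_ne_zero _ hd), Finset.prod_inv_distrib,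
    Finset.prod_sigma', Finset.univ_sigma_univ]
  congr 2
  exact Fintype.prod_equiv finSigmaFinEquiv.symm _ _ fun s => rfl

theorem extAct_id (hd : d ≠ 0) (hR : R.LoopsEq d) (Y : Box) (x : Fin 1 → extSpace R d Y) :
    extAct hd hR (X := fun _ => Y) (Pod.id Y) x = x 0 := by
  apply Subtype.ext
  rw [extAct_coe]
  -- The normalized action of the identity pod is `plusProj`, so the claim is the fixed-point
  -- equation that defines the space.
  refine Eq.trans ?_ (x 0).2
  have : (fun i => (x i : R.V Y.plus)) = fun _ => (x 0 : R.V Y.plus) :=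
    funext fun i => by rw [Subsingleton.elim i 0]
  rw [this, Finset.prod_const, Finset.card_univ, Fintype.card_fin, pow_one]
  rfl

/-- The extension of a representation to the boxes of sign `-`. -/
noncomputable def ext (hd : d ≠ 0) (hR : R.LoopsEq d) : RepAD.{u, v} K where
  V X := extSpace R d X
  addCommGroup _ := inferInstance
  module _ := inferInstance
  act {_ X Y} T := extAct hd hR (X := X) (Y := Y) T
  act_id Y x := extAct_id hd hR Y x
  act_plug T S x := extAct_plug hd hR T S x

theorem ext_act_coe (hd : d ≠ 0) (hR : R.LoopsEq d) {k : ℕ} {X : Fin k → Box} {Y : Box}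
    (T : Pod X Y) (x : ∀ i, (ext hd hR).V (X i)) :
    ((ext hd hR).act (X := X) (Y := Y) T x).1 = (∏ j, d ^ (X j).offset)⁻¹ •
      R.act (X := fun j => (X j).plus) (Y := Y.plus) T.plus fun i => (x i).1 :=
  rfl

theorem ext_loopsEq (hd : d ≠ 0) (hR : R.LoopsEq d) : (ext hd hR).LoopsEq d := by
  intro k X Y D D₀ h
  ext x
  have h1 := hR (X := fun j => (X j).plus) (Y := Y.plus) _ _ (AddsLoop.plus h)
  have h2 := congrArg (fun f => (∏ j, d ^ (X j).offset)⁻¹ • f fun i => (x i).1) h1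
  simp only [smul_apply] at h2
  rw [smul_comm] at h2
  exact Subtype.ext h2

/-! ### Agreement with the given representation on positive boxes -/

/-- Equal objects have isomorphic spaces. -/
def castSpace (R : RepADPos.{u, v} K) {A B : PosBox} (h : A = B) : R.V A ≃ₗ[K] R.V B :=
  h ▸ LinearEquiv.refl K (R.V A)

theorem castSpace_act {k : ℕ} {X X' : Fin k → PosBox} {Y Y' : PosBox}
    (hX : ∀ i, X i = X' i) (hY : Y = Y') (D : Diagram (fun i => (X i).1) Y.1)
    (D' : Diagram (fun i => (X' i).1) Y'.1) (hD : D.word = D'.word) (x : ∀ i, R.V (X i)) :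
    castSpace R hY (R.act D.pod x) = R.act D'.pod fun i => castSpace R (hX i) (x i) := by
  obtain rfl : X = X' := funext hX
  subst hY
  obtain rfl : D = D' := Diagram.ext hD
  rfl

theorem Diagram.plus_word_of_pos {k : ℕ} {X : Fin k → PosBox} {Y : PosBox}
    (D : Diagram (fun i => (X i).1) Y.1) : D.plus.word = D.word := by
  have h : ∀ X : PosBox, X.1.offset = 0 := fun X => by simp [Box.offset, X.2]
  have h' : ∀ j, closeWord (X j).1 j = [⟨0, Gen.box j⟩] := fun j => by simp [closeWord, (X j).2]
  simp only [Diagram.plus_word, h, h', shift_zero, sub_box]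

/-- Matching on the sign lets `Box.plus` reduce; no arc or string is then added and the pod is the
identity. -/
theorem plusProj_of_pos : ∀ (X : PosBox) (x : R.V X.1.plus), plusProj R d X.1 x = x
  | ⟨⟨true, m, n, h⟩, _⟩, x => by
      refine (congrArg (· • R.op (X := Box.plus ⟨true, m, n, h⟩) (Y := Box.plus ⟨true, m, n, h⟩)
        (Diagram.id ⟨true, m, n, h⟩).plus.pod x) (by simp [Box.offset] : _ = (1 : K))).trans ?_
      rw [one_smul]
      have e : (Diagram.id ⟨true, m, n, h⟩).plus = Diagram.id ⟨true, m, n, h⟩ :=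
        Diagram.ext (Diagram.plus_word_of_pos (X := fun _ : Fin 1 => ⟨⟨true, m, n, h⟩, rfl⟩)
          (Y := ⟨⟨true, m, n, h⟩, rfl⟩) _)
      rw [e]
      exact op_id R ⟨⟨true, m, n, h⟩, rfl⟩ x

/-- The space of the extended representation at a box of sign `+` is the given one. -/
noncomputable def extEquiv (R : RepADPos.{u, v} K) (d : K) (X : PosBox) :
    extSpace R d X.1 ≃ₗ[K] R.V X :=
  (LinearEquiv.ofTop (extSpace R d X.1)
    (eq_top_iff.2 fun x _ => plusProj_of_pos X x)).trans (castSpace R (Box.plus_val X))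

/-- The extended representation restricts to the given one. -/
noncomputable def extIso (hd : d ≠ 0) (hR : R.LoopsEq d) : (ext hd hR).restrict.Iso R where
  equiv X := extEquiv R d X
  equiv_act {k X Y} T x := by
    obtain ⟨D, rfl⟩ : ∃ D : Diagram (fun i => (X i).1) Y.1, T = D.pod :=
      ⟨_, (Quot.out_eq T).symm⟩
    refine Eq.trans ?_ (castSpace_act (fun i => Box.plus_val (X i)) (Box.plus_val Y) D.plus D
      D.plus_word_of_pos fun i => (x i).1)
    refine congrArg (castSpace R (Box.plus_val Y)) ?_
    refine (ext_act_coe hd hR (X := fun i => (X i).1) D.pod x).trans ?_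
    have h : (∏ j, d ^ (X j).1.offset)⁻¹ = 1 := by simp [Box.offset, (X _).2]
    rw [h, one_smul]
    rfl

end ext

/-! ### The structure of an arbitrary extension -/

section extension

variable {K : Type u} [Field K] {E : RepAD.{u, v} K} {R : RepADPos.{u, v} K} {d : K}

/-- The map `a ↦ 1 ⊗ a` for boxes of sign `-`; the given identification for boxes of
sign `+`. -/
def embPlus (φ : E.restrict.Iso R) (X : Box) : E.V X →ₗ[K] R.V X.plus :=
  (φ.equiv X.plus).toLinearMap ∘ₗ E.op (X := X) (Y := X.plus.1) (openBox X).pod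

theorem isFilling_box {k : ℕ} (X : Fin k → Box) : IsFilling X X fun j => [⟨0, Gen.box j⟩] where
  runs j := by simp [Runs, Gen.src, Gen.tgt, Gen.Fits, altSign]
  once i := by simp [boxCount]

theorem isFilling_loop_box {k : ℕ} (X : Fin k → Box) : IsFilling X X fun j =>
    bif (X j).sign then [⟨0, Gen.box j⟩] else loopWord [⟨0, Gen.box j⟩] :=
  (isFilling_box X).add_loops fun j => by cases (X j).sign <;> simp

theorem act_fill_loop_box (hE : E.LoopsEq d) {k : ℕ} {X : Fin k → Box} {Y : Box}
    (D : Diagram X Y) : E.act (X := X) (Y := Y) (D.fill _ (isFilling_loop_box X)).pod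
      = (∏ j, d ^ (X j).offset) • E.act (X := X) (Y := Y) D.pod := by
  have h := act_fill_loops (Z := X) (Y := Y) hE D (isFilling_box X) (isFilling_loop_box X)
    fun _ => rfl
  have e : D.fill _ (isFilling_box X) = D := Diagram.ext (sub_box _)
  rwa [e] at h

/-- The composite is the identity diagram with a loop beside the box when `X` is negative. -/
theorem close_open (hE : E.LoopsEq d) (X : Box) (a : E.V X) :
    E.op (X := X.plus.1) (Y := X) (closeBox X).pod
      (E.op (X := X) (Y := X.plus.1) (openBox X).pod a) = d ^ X.offset • a := by
  have h := op_act E (X := fun _ : Fin 1 => X) (Y := X.plus.1) (Y' := X) (closeBox X) (openBox X)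
    ((Diagram.id X).fill _ (isFilling_loop_box _)) ?_ fun _ => a
  · refine h.trans ?_
    rw [act_fill_loop_box hE, smul_apply]
    refine Eq.trans ?_ (congrArg (d ^ X.offset • ·) (op_id E X a))
    rw [Finset.prod_const, Finset.card_univ, Fintype.card_fin, pow_one]
    rfl
  · simp only [Diagram.fill, Diagram.id, closeBox_word, openBox_word, sub_cons_box, sub_nil,
      shift_zero, List.append_nil]
    rw [sub_closeWord _ _ _ [⟨0, Gen.box 0⟩] rfl]

theorem embPlus_injective (hd : d ≠ 0) (hE : E.LoopsEq d) (φ : E.restrict.Iso R) (X : Box) :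
    Function.Injective (embPlus φ X) := by
  refine (φ.equiv X.plus).injective.comp fun a b hab => ?_
  have h := congrArg (E.op (X := X.plus.1) (Y := X) (closeBox X).pod) hab
  exact smul_right_injective _ (pow_ne_zero _ hd)
    ((close_open hE X a).symm.trans (h.trans (close_open hE X b)))

/-- Plugging opened boxes into `T.plus` returns `T` with its outer box opened and one loop at each
negative inner box; the inverse powers of d remove these loops. -/
theorem embPlus_act (hd : d ≠ 0) (hE : E.LoopsEq d) (φ : E.restrict.Iso R) {k : ℕ}
    {X : Fin k → Box} {Y : Box} (T : Pod X Y) (x : ∀ i, E.V (X i)) :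
    embPlus φ Y (E.act (X := X) (Y := Y) T x) = (∏ j, d ^ (X j).offset)⁻¹ •
      R.act (X := fun j => (X j).plus) (Y := Y.plus) T.plus fun i => embPlus φ (X i) (x i) := by
  obtain ⟨D, rfl⟩ : ∃ D : Diagram X Y, T = D.pod := ⟨_, (Quot.out_eq T).symm⟩
  have h1 := φ.equiv_act (X := fun j => (X j).plus) (Y := Y.plus) D.plus.pod
    fun i => E.op (X := X i) (Y := (X i).plus.1) (openBox (X i)).pod (x i)
  have h2 := act_op E (X := fun j => (X j).plus.1) (Z := X) (Y := Y.plus.1) D.plus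
    (fun j => openBox (X j)) (D.openLeft.fill _ (isFilling_loop_box X)) (by
      simp only [Diagram.fill, Diagram.openLeft, Diagram.plus_word, sub_shift, sub_sub]
      congr 2
      funext j
      rw [sub_closeWord _ _ _ [⟨0, Gen.box j⟩] rfl]) x
  have h3 := op_act E (X := X) (Y := Y) (Y' := Y.plus.1) (openBox Y) D D.openLeft
    (by simp [openBox_word, Diagram.openLeft]) x
  rw [act_fill_loop_box hE, smul_apply, ← h3] at h2
  refine (eq_inv_smul_iff₀ (Finset.prod_ne_zero_iff.2 fun j _ => pow_ne_zero _ hd)).2 ?_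
  refine Eq.trans ?_ h1
  exact ((φ.equiv Y.plus).map_smul _ _).symm.trans (congrArg (φ.equiv Y.plus) h2.symm)

/-- This is `embPlus_act` for the identity pod. -/
theorem plusProj_embPlus (hd : d ≠ 0) (hE : E.LoopsEq d) (φ : E.restrict.Iso R) {X : Box}
    (a : E.V X) : plusProj R d X (embPlus φ X a) = embPlus φ X a := by
  have h := embPlus_act hd hE φ (X := fun _ => X) (Pod.id X) fun _ => a
  have h' : E.act (X := fun _ : Fin 1 => X) (Y := X) (Pod.id X) (fun _ => a) = a := op_id E X a
  rw [h'] at h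
  rw [Finset.prod_const, Finset.card_univ, Fintype.card_fin, pow_one] at h
  exact h.symm

theorem range_embPlus (hd : d ≠ 0) (hE : E.LoopsEq d) (φ : E.restrict.Iso R) (X : Box) :
    LinearMap.range (embPlus φ X) = extSpace R d X := by
  refine le_antisymm ?_ fun y hy => ?_
  · rintro _ ⟨a, rfl⟩
    exact plusProj_embPlus hd hE φ a
  · obtain ⟨z, rfl⟩ := (φ.equiv X.plus).surjective y
    rw [mem_extSpace] at hy
    -- A fixed vector equals its own projection, which is a scalar multiple of opening after closing
    -- and so lies in the range of opening.
    rw [← hy]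
    refine Submodule.smul_mem _ _ ⟨E.op (X := X.plus.1) (Y := X) (closeBox X).pod z, ?_⟩
    have h1 := φ.equiv_act (X := fun _ : Fin 1 => X.plus) (Y := X.plus) (Diagram.id X).plus.pod
      fun _ => z
    have h2 := op_act E (X := fun _ : Fin 1 => X.plus.1) (Y := X) (Y' := X.plus.1) (openBox X)
      (closeBox X) (Diagram.id X).plus (by
        simp [openBox_word, closeBox_word, Diagram.plus_word, Diagram.id]) fun _ => z
    exact (congrArg (φ.equiv X.plus) h2).trans h1

/-! ### Comparison with an arbitrary extension -/

/-- The comparison of the spaces of the extended representation with those of another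
extension. -/
noncomputable def compareEquiv (hd : d ≠ 0) (hE : E.LoopsEq d) (φ : E.restrict.Iso R) (X : Box) :
    extSpace R d X ≃ₗ[K] E.V X :=
  ((LinearEquiv.ofInjective _ (embPlus_injective hd hE φ X)).trans
    (LinearEquiv.ofEq _ _ (range_embPlus hd hE φ X))).symm

theorem embPlus_compareEquiv (hd : d ≠ 0) (hE : E.LoopsEq d) (φ : E.restrict.Iso R) (X : Box)
    (a : extSpace R d X) : embPlus φ X (compareEquiv hd hE φ X a) = a :=
  congrArg Subtype.val ((compareEquiv hd hE φ X).symm_apply_apply a)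

/-- The comparison of the extended representation with another extension. -/
noncomputable def compareIso (hd : d ≠ 0) (hR : R.LoopsEq d) (hE : E.LoopsEq d)
    (φ : E.restrict.Iso R) : (ext hd hR).Iso E where
  equiv X := compareEquiv hd hE φ X
  equiv_act {k X Y} T x := by
    apply embPlus_injective hd hE φ Y
    refine (embPlus_compareEquiv hd hE φ Y _).trans ?_
    refine Eq.trans ?_ (embPlus_act hd hE φ T _).symm
    refine (ext_act_coe hd hR (X := X) (Y := Y) T x).trans ?_
    congr 2
    funext i
    exact (embPlus_compareEquiv hd hE φ (X i) (x i)).symm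

theorem castSpace_embPlus (φ : E.restrict.Iso R) :
    ∀ (X : PosBox) (a : E.V X.1), castSpace R (Box.plus_val X) (embPlus φ X.1 a) = φ.equiv X a
  | ⟨⟨true, m, n, h⟩, _⟩, a => by
      have e : openBox ⟨true, m, n, h⟩ = Diagram.id ⟨true, m, n, h⟩ :=
        Diagram.ext (shift_zero _)
      refine congrArg (φ.equiv ⟨⟨true, m, n, h⟩, rfl⟩) ?_
      refine Eq.trans ?_ (op_id E ⟨true, m, n, h⟩ a)
      rw [e]
      rfl

theorem compareIso_compatible (hd : d ≠ 0) (hR : R.LoopsEq d) (hE : E.LoopsEq d)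
    (φ : E.restrict.Iso R) (X : PosBox) (a : (ext hd hR).V X.1) :
    φ.equiv X ((compareIso hd hR hE φ).equiv X.1 a) = (extIso hd hR).equiv X a := by
  rw [← castSpace_embPlus]
  exact congrArg (castSpace R (Box.plus_val X)) (embPlus_compareEquiv hd hE φ X.1 a)

/-- `embPlus` is the action of a pod followed by an identification on a positive box; `ψ` respects
the former by naturality and the latter by compatibility. -/
theorem embPlus_of_compatible {E' : RepAD.{u, v} K} {φ : E.restrict.Iso R}
    {φ' : E'.restrict.Iso R} (ψ : E.Iso E')
    (h : ∀ (X : PosBox) (a : E.V X.1), φ'.equiv X (ψ.equiv X.1 a) = φ.equiv X a) (X : Box)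
    (a : E.V X) : embPlus φ' X (ψ.equiv X a) = embPlus φ X a := by
  refine Eq.trans ?_ (h X.plus (E.op (X := X) (Y := X.plus.1) (openBox X).pod a))
  exact congrArg (φ'.equiv X.plus)
    (ψ.equiv_act (X := fun _ : Fin 1 => X) (Y := X.plus.1) (openBox X).pod fun _ => a).symm

theorem Rep.Iso.ext_equiv {O : Type} {o : O → Box} {S S' : Rep.{u, v} K o} {ψ ψ' : S.Iso S'}
    (h : ∀ X a, ψ.equiv X a = ψ'.equiv X a) : ψ = ψ' := by
  obtain ⟨e, _⟩ := ψ
  obtain ⟨e', _⟩ := ψ'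
  obtain rfl : e = e' := funext fun X => LinearEquiv.ext (h X)
  rfl

theorem embNeg_eq_embPlus (φ : E.restrict.Iso R) (m n : ℕ) (h : Even (m + n)) :
    embNeg φ m n h = embPlus φ (negBox m n h) := rfl

theorem plusProj_negBox (m n : ℕ) (h : Even (m + n)) :
    plusProj R d (negBox m n h) = d⁻¹ • R.op (oneTensorC m n h).pod := by
  have e : (Diagram.id (negBox m n h)).plus = oneTensorC m n h := Diagram.ext rfl
  have ho : (negBox m n h).offset = 1 := rfl
  rw [plusProj, e, ho, pow_one]
  rfl

theorem isProj_embPlus (hd : d ≠ 0) (hR : R.LoopsEq d) (hE : E.LoopsEq d)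
    (φ : E.restrict.Iso R) (X : Box) :
    LinearMap.IsProj (LinearMap.range (embPlus φ X)) (plusProj R d X) := by
  rw [range_embPlus hd hE]
  refine ⟨fun x => ?_, fun x hx => hx⟩
  exact Submodule.smul_mem _ _
    (plusProj_act hd hR (X := fun _ : Fin 1 => X) (Pod.id X) fun _ => x)

end extension

end AltPod

open AltPod in
/-- Let `R` be a representation of the multicategory of `+`-starting alternating pods in which
anticlockwise loops have the value `d ≠ 0`. Then `R` extends to a representation `E` of all
alternating pods with the same property, the `-`-spaces of `E` are realized as the images of the
projections `d⁻¹ π_{1 ⊗ C}`, and any other such extension is isomorphic to `E` by a unique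
isomorphism that is compatible with the identifications on the `+`-part. -/
theorem mainTheorem5 {K : Type*} [Field K] (d : K) (hd : d ≠ 0)
    (R : RepADPos K) (hR : R.LoopsEq d) :
    ∃ (E : RepAD K) (φ : E.restrict.Iso R), E.LoopsEq d ∧
      (∀ (m n : ℕ) (h : Even (m + n)),
        Function.Injective (embNeg φ m n h) ∧
          LinearMap.IsProj (LinearMap.range (embNeg φ m n h))
            (d⁻¹ • R.op (oneTensorC m n h).pod)) ∧
      ∀ (E' : RepAD K) (φ' : E'.restrict.Iso R), E'.LoopsEq d →
        ∃! ψ : E.Iso E', ∀ (X : PosBox) (a : E.V X.1),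
          φ'.equiv X (ψ.equiv X.1 a) = φ.equiv X a := by
  have hE : (ext hd hR).LoopsEq d := ext_loopsEq hd hR
  refine ⟨ext hd hR, extIso hd hR, hE, fun m n h => ⟨?_, ?_⟩, fun E' φ' hE' => ?_⟩
  · exact embPlus_injective hd hE (extIso hd hR) (negBox m n h)
  · rw [← plusProj_negBox, embNeg_eq_embPlus]
    exact isProj_embPlus hd hR hE (extIso hd hR) (negBox m n h)
  · refine ⟨compareIso hd hR hE' φ', compareIso_compatible hd hR hE' φ', fun ψ hψ => ?_⟩
    -- Compatibility fixes `ψ` after composition with the injective opening map of `E'`, also at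
    -- negative boxes.
    refine Rep.Iso.ext_equiv fun X a => embPlus_injective hd hE' φ' X ?_
    rw [embPlus_of_compatible ψ hψ, embPlus_of_compatible _ (compareIso_compatible hd hR hE' φ')]
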